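/- Conventions. An instance consists of finite alphabets $\Sigma_I,\Sigma_B,\Sigma_O$; a deterministic finite automaton $\mathcal A_R$ (at most one successor per state and letter) over $\Sigma_I\times\Sigma_O$, describing the length-preserving relation $R\subseteq\Sigma_I^*\times\Sigma_O^*$ of all pairs $(x,y)$ with $|x|=|y|$ whose interleaving is accepted by $\mathcal A_R$; and a transducer (Moore machine) $T_2$ with input alphabet $\Sigma_B$ and output alphabet $\Sigma_O$ (the hint). A strategy $f:\Sigma^*\to\Sigma'$ (only its values on nonempty words matter) induces the function $\Sigma^*\to\Sigma'^*$, $a_1\cdots a_n\mapsto f(a_1)f(a_1a_2)\cdots f(a_1\cdots a_n)$, regarded as a relation $R_f\subseteq\Sigma^*\times\Sigma'^*$; a transducer $T$ realizes the strategy sending a word $w$ to the output letter of the state reached on $w$, and $R_T$ denotes the induced relation. A pair $(R_1,R_2)$ with $R_1\subseteq\Sigma_I^*\times\Sigma_B^*$, $R_2\subseteq\Sigma_B^*\times\Sigma_O^*$ meets the PD condition for $R$ if $\mathrm{Img}(R_1)\subseteq\mathrm{Dom}(R_2)$, $\mathrm{Dom}(R_1\circ R_2)=\mathrm{Dom}(R)$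 and $R_1\circ R_2\subseteq R$. Strategic PDP with a hint $T_2$ asks whether there is a (finite-state) transducer $T_1$ with input alphabet $\Sigma_I$ and output alphabet $\Sigma_B$ such that $(R_{T_1},R_{T_2})$ meets the PD condition for $R$. Instances are encoded as binary strings by writing out the machines as tables, with numbers in unary, so that the length of the encoding is polynomially related to the numbers of states, letters and transitions. Theorem. (1) Strategic PDP with a hint $T_2$ is in PTIME: a Turing machine decides it in time polynomial in the length of the encoding of the instance. (2) A Turing machine computes, in time polynomial in the length of the encoding, a transducer $T_1$ such that $(R_{T_1},R_{T_2})$ meets the PD condition for $R$ if one exists, and reports that there is none otherwise. (3) There is a polynomial $p$ such that for every instance with encoding of length $\ell$ there is a deterministic Büchi tree automaton on full $\Sigma_B$-labelled $\Sigma_I$-trees, of size at most $p(\ell)$ (states, letters, directions and transition-table entries), which accepts a labelled tree $\tau:\Sigma_I^*\to\Sigma_B$ if and only if $(R_\tau,R_{T_2})$ meets the PD condition for $R$; and its language is nonempty if and only if the instance has a solution $T_1$. (In particular, by (1), its nonemptiness is decided in polynomial time.) -/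

import Mathlib

open Turing Filter

/-! ### Relations and the partial-decomposition condition -/

/-- `(R₁, R₂)` meets the PD condition for `R`: `Img R₁ ⊆ Dom R₂`, `Dom (R₁ ∘ R₂) = Dom R` and
`R₁ ∘ R₂ ⊆ R`, where `R₁ ∘ R₂ = {(a, c) | ∃ b, (a, b) ∈ R₁ ∧ (b, c) ∈ R₂}`. -/
def MeetsPD {α β γ : Type*} (R : SetRel α γ) (R₁ : SetRel α β) (R₂ : SetRel β γ) : Prop :=
  R₁.cod ⊆ R₂.dom ∧ (R₁.comp R₂).dom = R.dom ∧ R₁.comp R₂ ⊆ R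

/-! ### Deterministic automata and automatic relations -/

/-- A deterministic finite automaton in the sense "at most one successor for every state and
letter": the transition function may be undefined (`none`). -/
structure PartialDFA (α σ : Type*) where
  step : σ → α → Option σ
  start : σ
  accept : σ → Bool

namespace PartialDFA

/-- The state reached from `s` on a word, if the run exists. -/
def evalFrom {α σ : Type*} (A : PartialDFA α σ) : σ → List α → Option σ
  | s, [] => some s
  | s, a :: w => (A.step s a).bind fun t => A.evalFrom t w

/-- Acceptance of a word. -/
def Accepts {α σ : Type*} (A : PartialDFA α σ) (w : List α) : Prop :=
  ∃ s, A.evalFrom A.start w = some s ∧ A.accept s = true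

/-- The (length-preserving) automatic relation described by an automaton over a product
alphabet. -/
def rel {α β σ : Type*} (A : PartialDFA (α × β) σ) : SetRel (List α) (List β) :=
  {p | p.1.length = p.2.length ∧ A.Accepts (p.1.zip p.2)}

end PartialDFA

/-! ### Strategies and transducers -/

/-- The word function of a strategy `f`, as a relation: the word `a₁ ⋯ aₙ` is related exactly to
`f(a₁) f(a₁a₂) ⋯ f(a₁⋯aₙ)`. The value of `f` on the empty word (the label of the root, when `f` is
seen as a labelled tree) is ignored, so that the relation is length-preserving. -/
def strategyRel {α β : Type*} (f : List α → β) : SetRel (List α) (List β) :=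
  {p | p.2 = p.1.inits.tail.map f}

/-- A transducer (Moore machine). -/
structure Transducer (α β σ : Type*) where
  step : σ → α → σ
  start : σ
  out : σ → β

namespace Transducer

/-- The state reached after reading a word. -/
def state {α β σ : Type*} (T : Transducer α β σ) (w : List α) : σ :=
  w.foldl T.step T.start

/-- The strategy realized by `T`: the output letter of the state reached. -/
def strategy {α β σ : Type*} (T : Transducer α β σ) (w : List α) : β :=
  T.out (T.state w)

/-- The word function of the transducer `T`, as a relation. -/
def rel {α β σ : Type*} (T : Transducer α β σ) : SetRel (List α) (List β) :=
  strategyRel T.strategy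

end Transducer

/-! ### Strategic PDP with a hint `T₂` -/

/-- An instance of strategic PDP with a hint `T₂`: the finite alphabets `Σ_I`, `Σ_B`, `Σ_O` with
`nI`, `nB`, `nO` letters, a DFA `A` over `Σ_I × Σ_O` with `nQ` states describing the relation, and a
transducer `T₂` from `Σ_B` to `Σ_O` with `nP` states. -/
structure HintInstance where
  nI : ℕ
  nB : ℕ
  nO : ℕ
  nQ : ℕ
  nP : ℕ
  A : PartialDFA (Fin nI × Fin nO) (Fin nQ)
  T₂ : Transducer (Fin nB) (Fin nO) (Fin nP)

namespace HintInstance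

/-- The candidate solutions `T₁`: transducers from `Σ_I` to `Σ_B` with any finite number of
states. -/
abbrev Candidate (I : HintInstance) : Type :=
  Σ n : ℕ, Transducer (Fin I.nI) (Fin I.nB) (Fin n)

/-- `(T₁, T₂)` meets the PD condition for the relation described by `A`. -/
def IsSolution (I : HintInstance) (T₁ : I.Candidate) : Prop :=
  MeetsPD I.A.rel T₁.2.rel I.T₂.rel

/-- The decision problem: is there a solution `T₁`? -/
def Solvable (I : HintInstance) : Prop :=
  ∃ T₁ : I.Candidate, I.IsSolution T₁

end HintInstance

/-! ### Representation by binary strings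

Machines are written out as tables of numbers, and numbers in unary (`n` is `1ⁿ0`). The length of
the resulting string is polynomially related to the usual size (number of states, letters and
transitions) of the machines. -/

/-- Unary, self-delimiting code of a list of numbers. -/
def encodeNats (l : List ℕ) : List Bool :=
  l.flatMap fun n => List.replicate n true ++ [false]

/-- Number of states, start state, acceptance bits, transition table (`0` for an undefined
transition, `t + 1` for the successor `t`). -/
def PartialDFA.table {a b n : ℕ} (A : PartialDFA (Fin a × Fin b) (Fin n)) : List ℕ :=
  [n, (A.start : ℕ)]
    ++ (List.finRange n).map (fun s => if A.accept s then 1 else 0)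
    ++ (List.finRange n).flatMap fun s => (List.finRange a).flatMap fun i =>
        (List.finRange b).map fun o => (A.step s (i, o)).elim 0 fun t => (t : ℕ) + 1

/-- Number of states, start state, output letters, transition table. -/
def Transducer.table {a b n : ℕ} (T : Transducer (Fin a) (Fin b) (Fin n)) : List ℕ :=
  [n, (T.start : ℕ)]
    ++ (List.finRange n).map (fun s => (T.out s : ℕ))
    ++ (List.finRange n).flatMap fun s => (List.finRange a).map fun i => (T.step s i : ℕ)

/-- The binary string representing an instance. -/
def HintInstance.encode (I : HintInstance) : List Bool :=
  encodeNats ([I.nI, I.nB, I.nO] ++ I.A.table ++ I.T₂.table)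

/-- The binary string representing the answer of the search problem: `0` for "no solution",
otherwise `1` followed by a transducer. -/
def HintInstance.encodeAnswer (I : HintInstance) : Option I.Candidate → List Bool
  | none => [false]
  | some T₁ => true :: encodeNats T₁.2.table

/-! ### Polynomial time -/

/-- `P` is decided by a Turing machine in time polynomial in the length of the encoding. -/
def PolyTimeDecidable {α : Type} (enc : α → List Bool) (P : α → Prop) : Prop :=
  ∃ f : α → Bool, (∀ a, f a = true ↔ P a) ∧
    Nonempty (TM2ComputableInPolyTime enc Computability.encodeBool f)

/-- `g` is computed by a Turing machine in time polynomial in the length of the encoding. -/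
def PolyTimeComputable {α : Type} (enc : α → List Bool) (g : α → List Bool) : Prop :=
  Nonempty (TM2ComputableInPolyTime enc id g)

/-! ### Deterministic tree automata -/

/-- A deterministic Büchi automaton on full `Λ`-labelled `Υ`-trees. In state `s` at a node labelled
`l`, either the transition is `false` (`none`), or it is a conjunction that sends at most one state
in each direction. -/
structure DetTreeAutomaton (Υ Λ σ : Type*) where
  step : σ → Λ → Option (Υ → Option σ)
  start : σ
  acc : Set σ

namespace DetTreeAutomaton

/-- `r` is a run on the labelled tree `V`: `r x` is the state of the copy of the automaton that
visits the node `x`, or `none` if no copy does. The child of `x` in direction `v` is `x ++ [v]`. -/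
structure IsRun {Υ Λ σ : Type*} (D : DetTreeAutomaton Υ Λ σ) (V : List Υ → Λ)
    (r : List Υ → Option σ) : Prop where
  root : r [] = some D.start
  child : ∀ x s, r x = some s → ∃ f, D.step s (V x) = some f ∧ ∀ v, r (x ++ [v]) = f v
  unvisited : ∀ x, r x = none → ∀ v, r (x ++ [v]) = none

/-- Acceptance of a labelled tree: there is a run whose infinite paths all visit `acc` infinitely
often. -/
def Accepts {Υ Λ σ : Type*} (D : DetTreeAutomaton Υ Λ σ) (V : List Υ → Λ) : Prop :=
  ∃ r, D.IsRun V r ∧ ∀ d : ℕ → Υ, (∀ n, (r ((List.range n).map d)).isSome) →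
    ∃ᶠ n in atTop, ∃ s ∈ D.acc, r ((List.range n).map d) = some s

/-- The size: states, letters, directions and entries of the transition table. -/
def size {a b n : ℕ} (_D : DetTreeAutomaton (Fin a) (Fin b) (Fin n)) : ℕ :=
  n + b + a + n * b * a

end DetTreeAutomaton

/-! Both word functions are total and length-preserving, so the PD condition collapses to a safety
condition: on every input word, the run of `A` on the word paired with the composite output exists
and ends in an accepting state (`meetsPD_iff`). This is a game on pairs of a state of `A` and a
state of `T₂`: the environment picks an input letter, the player answers with a letter of `Σ_B`, and
the play must stay in accepting positions forever.

The sets `safe k` decrease among `nQ * nP` positions, so they are stationary after that many rounds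
(`safeStep_winning`). A strategy that meets the condition, finite-state or not, makes the start
position winning (`startPos_mem_winning`); conversely, always playing the least letter that stays
winning is a finite transducer (`meetsPD_solution`). Solvability by trees and by transducers
therefore coincide, which serves decision, search and nonemptiness alike. The tree automaton carries
the position down the tree and gets stuck when it is undefined or rejecting; all its states are
accepting (`treeAutomaton_accepts_iff`).

For the time bounds, a while language on stacks is compiled to `TM2` machines with exact step counts
(`Runs.evals`). The class `PT` asks for programs that write their value to the first free stack and
restore the rest, so that programs nest like expressions. Its main closure property is `PT.iterate`:
iteration stays polynomial as long as the intermediate values have polynomially bounded length.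
Unary arithmetic, table lookup and the fixpoint iteration, whose values are bit lists of constant
length, are built on it. -/

/-! ### A while language on stacks of bits, compiled to `TM2` machines -/

/-- Programs on stacks of bits indexed by numbers. `ite k p q` tests whether the top of stack `k`
is `true`, and `loop k p` repeats `p` as long as stack `k` is nonempty. -/
inductive StackProg where
  | skip : StackProg
  | push (k : ℕ) (b : Bool) : StackProg
  | pop (k : ℕ) : StackProg
  | seq (p q : StackProg) : StackProg
  | ite (k : ℕ) (p q : StackProg) : StackProg
  | loop (k : ℕ) (p : StackProg) : StackProg

namespace StackProg

/-- Big-step semantics: `Runs p s s' t` if `p`, started on the stacks `s`, ends after `t` steps with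
the stacks `s'`. -/
inductive Runs : StackProg → (ℕ → List Bool) → (ℕ → List Bool) → ℕ → Prop
  | skip (s) : Runs skip s s 1
  | push (s) (k : ℕ) (b : Bool) : Runs (push k b) s (Function.update s k (b :: s k)) 1
  | pop (s) (k : ℕ) : Runs (pop k) s (Function.update s k (s k).tail) 1
  | seq {p q s s' s'' t u} : Runs p s s' t → Runs q s' s'' u → Runs (seq p q) s s'' (t + u)
  | ite_true {k p q s s' t} : (s k).head? = some true → Runs p s s' t →
      Runs (ite k p q) s s' (1 + t)
  | ite_false {k p q s s' t} : (s k).head? ≠ some true → Runs q s s' t →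
      Runs (ite k p q) s s' (1 + t)
  | loop_nil {k p s} : s k = [] → Runs (loop k p) s s 1
  | loop_cons {k p s s' s'' t u} : s k ≠ [] → Runs p s s' t → Runs (loop k p) s' s'' u →
      Runs (loop k p) s s'' (1 + (t + u))

/-- All stacks used by the program are among the first `N + 1` ones. -/
def UsesUpTo (N : ℕ) : StackProg → Prop
  | skip => True
  | push k _ => k ≤ N
  | pop k => k ≤ N
  | seq p q => p.UsesUpTo N ∧ q.UsesUpTo N
  | ite k p q => k ≤ N ∧ p.UsesUpTo N ∧ q.UsesUpTo N
  | loop k p => k ≤ N ∧ p.UsesUpTo N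

theorem UsesUpTo.mono {N M : ℕ} (h : N ≤ M) : ∀ {p : StackProg}, p.UsesUpTo N → p.UsesUpTo M
  | skip, _ => trivial
  | push _ _, hp => le_trans hp h
  | pop _, hp => le_trans hp h
  | seq _ _, hp => ⟨hp.1.mono h, hp.2.mono h⟩
  | ite _ _ _, hp => ⟨hp.1.trans h, hp.2.1.mono h, hp.2.2.mono h⟩
  | loop _ _, hp => ⟨hp.1.trans h, hp.2.mono h⟩

theorem exists_usesUpTo (p : StackProg) : ∃ N, p.UsesUpTo N := by
  induction p with
  | skip => exact ⟨0, trivial⟩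
  | push k b => exact ⟨k, le_refl k⟩
  | pop k => exact ⟨k, le_refl k⟩
  | seq p q hp hq =>
    obtain ⟨N, hN⟩ := hp
    obtain ⟨M, hM⟩ := hq
    exact ⟨N + M, hN.mono (by omega), hM.mono (by omega)⟩
  | ite k p q hp hq =>
    obtain ⟨N, hN⟩ := hp
    obtain ⟨M, hM⟩ := hq
    exact ⟨k + N + M, by omega, hN.mono (by omega), hM.mono (by omega)⟩
  | loop k p hp =>
    obtain ⟨N, hN⟩ := hp
    exact ⟨k + N, by omega, hN.mono (by omega)⟩

/-- The labels of the machine code of a program. -/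
def Label : StackProg → Type
  | skip => Unit
  | push _ _ => Unit
  | pop _ => Unit
  | seq p q => p.Label ⊕ q.Label
  | ite _ p q => Option (p.Label ⊕ q.Label)
  | loop _ p => Option p.Label

/-- A program has finitely many labels. -/
instance fintypeLabel : (p : StackProg) → Fintype p.Label
  | skip => inferInstanceAs (Fintype Unit)
  | push _ _ => inferInstanceAs (Fintype Unit)
  | pop _ => inferInstanceAs (Fintype Unit)
  | seq p q =>
    haveI := p.fintypeLabel
    haveI := q.fintypeLabel
    inferInstanceAs (Fintype (p.Label ⊕ q.Label))
  | ite _ p q =>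
    haveI := p.fintypeLabel
    haveI := q.fintypeLabel
    inferInstanceAs (Fintype (Option (p.Label ⊕ q.Label)))
  | loop _ p =>
    haveI := p.fintypeLabel
    inferInstanceAs (Fintype (Option p.Label))

/-- The label at which the code of a program starts. -/
def entry : (p : StackProg) → p.Label
  | skip => ()
  | push _ _ => ()
  | pop _ => ()
  | seq p _ => Sum.inl p.entry
  | ite _ _ _ => none
  | loop _ _ => none

/-- The machine code of a program, with labels placed by `e` and exit label `x`. -/
def code {N : ℕ} {Λ : Type} : (p : StackProg) → (e : p.Label → Λ) → (x : Λ) → p.Label →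
    TM2.Stmt (fun _ : Fin (N + 1) => Bool) Λ (Option Bool)
  | skip, _, x, _ => .goto fun _ => x
  | push k b, _, x, _ => .push (Fin.ofNat (N + 1) k) (fun _ => b) (.goto fun _ => x)
  | pop k, _, x, _ => .pop (Fin.ofNat (N + 1) k) (fun _ o => o) (.goto fun _ => x)
  | seq p q, e, x, l => Sum.casesOn l
      (fun l => p.code (fun l => e (Sum.inl l)) (e (Sum.inr q.entry)) l)
      (fun l => q.code (fun l => e (Sum.inr l)) x l)
  | ite k p q, e, x, l => Option.casesOn l
      (.peek (Fin.ofNat (N + 1) k) (fun _ o => o) (.goto fun v =>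
        if v = some true then e (some (Sum.inl p.entry)) else e (some (Sum.inr q.entry))))
      (fun l => Sum.casesOn l
        (fun l => p.code (fun l => e (some (Sum.inl l))) x l)
        (fun l => q.code (fun l => e (some (Sum.inr l))) x l))
  | loop k p, e, x, l => Option.casesOn l
      (.peek (Fin.ofNat (N + 1) k) (fun _ o => o) (.goto fun v =>
        if v = none then x else e (some p.entry)))
      (fun l => p.code (fun l => e (some l)) (e none) l)

/-- Stack indices of the machine are taken modulo `N + 1`; the bound on `k` excludes wrap-around. -/
theorem restrict_update {N k : ℕ} (hk : k ≤ N) (s : ℕ → List Bool) (w : List Bool) :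
    (fun i : Fin (N + 1) => Function.update s k w i) =
      Function.update (fun i : Fin (N + 1) => s i) (Fin.ofNat (N + 1) k) w := by
  funext i
  have : (i : ℕ) = k ↔ i = Fin.ofNat (N + 1) k := by
    rw [Fin.ext_iff, Fin.val_ofNat, Nat.mod_eq_of_lt (by omega)]
  by_cases h : (i : ℕ) = k
  · rw [← this.1 h]; simp [h]
  · rw [Function.update_of_ne h, Function.update_of_ne (mt this.2 h)]

/-- The code of a program simulates its semantics, step by step. -/
theorem Runs.evals {p : StackProg} {s s' : ℕ → List Bool} {t : ℕ} (h : Runs p s s' t) {N : ℕ}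
    (hN : p.UsesUpTo N) {Λ : Type} (M : Λ → TM2.Stmt (fun _ : Fin (N + 1) => Bool) Λ (Option Bool))
    (e : p.Label → Λ) (x : Λ) (hM : ∀ l, M (e l) = p.code e x l) (v : Option Bool) :
    ∃ v', (flip Bind.bind (TM2.step M))^[t] (some ⟨some (e p.entry), v, fun i => s i⟩) =
      some ⟨some x, v', fun i => s' i⟩ := by
  have one (c : TM2.Cfg (fun _ : Fin (N + 1) => Bool) Λ (Option Bool)) :
      (flip Bind.bind (TM2.step M))^[1] (some c) = TM2.step M c := rfl
  have val {k : ℕ} (hk : k ≤ N) (s : ℕ → List Bool) : s (Fin.ofNat (N + 1) k) = s k := by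
    rw [Fin.val_ofNat, Nat.mod_eq_of_lt (by omega)]
  induction h generalizing x v with
  | skip s => exact ⟨v, by rw [one, TM2.step, hM]; simp [code]⟩
  | push s k b =>
    refine ⟨v, ?_⟩
    rw [one, TM2.step, hM, restrict_update hN]
    simp only [code, TM2.stepAux, val hN]
  | pop s k =>
    refine ⟨(s k).head?, ?_⟩
    rw [one, TM2.step, hM, restrict_update hN]
    simp only [code, TM2.stepAux, val hN]
  | @seq p q s s' s'' t u _ _ ihp ihq =>
    obtain ⟨v₁, h₁⟩ := ihp hN.1 (fun l => e (Sum.inl l)) (e (Sum.inr q.entry))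
      (fun l => hM (Sum.inl l)) v
    obtain ⟨v₂, h₂⟩ := ihq hN.2 (fun l => e (Sum.inr l)) x (fun l => hM (Sum.inr l)) v₁
    refine ⟨v₂, ?_⟩
    -- In `f^[u + t]` the inner block `f^[t]` runs first, hence the swap.
    rw [add_comm t u, Function.iterate_add_apply]
    exact (congrArg _ h₁).trans h₂
  | @ite_true k p q s s' t hk _ ih =>
    obtain ⟨v₁, h₁⟩ := ih hN.2.1 (fun l => e (some (Sum.inl l))) x
      (fun l => hM (some (Sum.inl l))) (some true)
    refine ⟨v₁, ?_⟩
    rw [add_comm 1 t, Function.iterate_add_apply, one, TM2.step]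
    refine Eq.trans (congrArg _ ?_) h₁
    erw [hM none]
    simp [code, TM2.stepAux, Nat.mod_eq_of_lt (Nat.lt_succ_of_le hN.1), hk]
  | @ite_false k p q s s' t hk _ ih =>
    obtain ⟨v₁, h₁⟩ := ih hN.2.2 (fun l => e (some (Sum.inr l))) x
      (fun l => hM (some (Sum.inr l))) (s k).head?
    refine ⟨v₁, ?_⟩
    rw [add_comm 1 t, Function.iterate_add_apply, one, TM2.step]
    refine Eq.trans (congrArg _ ?_) h₁
    erw [hM none]
    simp [code, TM2.stepAux, Nat.mod_eq_of_lt (Nat.lt_succ_of_le hN.1), hk]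
  | @loop_nil k p s hk =>
    refine ⟨none, ?_⟩
    rw [one, TM2.step]
    erw [hM none]
    simp [code, TM2.stepAux, Nat.mod_eq_of_lt (Nat.lt_succ_of_le hN.1), hk]
  | @loop_cons k p s s' s'' t u hk _ _ ih₁ ih₂ =>
    obtain ⟨v₁, h₁⟩ := ih₁ hN.2 (fun l => e (some l)) (e none) (fun l => hM (some l)) (s k).head?
    obtain ⟨v₂, h₂⟩ := ih₂ hN e x hM v₁
    refine ⟨v₂, ?_⟩
    rw [add_comm 1, add_comm t u, Function.iterate_add_apply, one, Function.iterate_add_apply]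
    refine Eq.trans (congrArg _ (Eq.trans (congrArg _ ?_) h₁)) h₂
    rw [TM2.step]
    erw [hM none]
    simp [code, TM2.stepAux, Nat.mod_eq_of_lt (Nat.lt_succ_of_le hN.1), hk]

/-- The machine running a program on stacks `0, …, N`, with input stack `0` and output
stack `1`. -/
def machine (N : ℕ) (p : StackProg) : FinTM2 :=
  haveI := p.fintypeLabel
  { K := Fin (N + 1)
    k₀ := Fin.ofNat (N + 1) 0
    k₁ := Fin.ofNat (N + 1) 1
    Γ := fun _ => Bool
    Λ := Option p.Label
    main := some p.entry
    σ := Option Bool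
    initialState := none
    -- The exit label `none` resets the internal variable, because a halting configuration must
    -- carry its initial value. This is the one step added to the running time.
    m := fun l => Option.casesOn l (.load (fun _ => none) .halt) fun l => p.code some none l }

/-- A program that turns every input on stack `0` into the output on stack `1`, with all other
stacks empty, in polynomial time yields a polynomial-time machine. -/
theorem computableInPolyTime {α β : Type} {ea : α → List Bool} {eb : β → List Bool} {f : α → β}
    (p : StackProg) (P : Polynomial ℕ)
    (h : ∀ a, ∃ t ≤ P.eval (ea a).length, Runs p (Function.update (fun _ => []) 0 (ea a))
      (Function.update (fun _ => []) 1 (eb (f a))) t) :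
    Nonempty (TM2ComputableInPolyTime ea eb f) := by
  obtain ⟨N, hN⟩ := p.exists_usesUpTo
  -- One more stack guarantees that stacks `0` and `1` are distinct.
  replace hN : p.UsesUpTo (N + 1) := hN.mono (Nat.le_succ N)
  refine ⟨{ tm := machine (N + 1) p
            inputAlphabet := Equiv.refl Bool
            outputAlphabet := Equiv.refl Bool
            time := P + 1
            outputsFun := fun a => Classical.choice ?_ }⟩
  obtain ⟨t, ht, hr⟩ := h a
  obtain ⟨v, hv⟩ := hr.evals hN (machine (N + 1) p).m some none (fun _ => rfl) none
  refine ⟨⟨1 + t, ?_⟩, ?_⟩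
  · rw [Function.iterate_add_apply]
    have h₀ : initList (machine (N + 1) p) (List.map (Equiv.refl Bool).invFun (ea a)) =
        ⟨some (some p.entry), none,
          fun i : Fin (N + 1 + 1) => Function.update (fun _ => []) 0 (ea a) (i : ℕ)⟩ := by
      refine congrArg (TM2.Cfg.mk _ _) (funext fun i : Fin (N + 1 + 1) => ?_)
      by_cases hi : i = Fin.ofNat (N + 1 + 1) 0
      · subst hi
        exact (dif_pos rfl).trans (List.map_id _)
      · have hi' : (i : ℕ) ≠ 0 := fun h => hi (Fin.ext (by rw [h]; simp))
        exact (dif_neg hi).trans (Function.update_of_ne hi' _ fun _ => []).symm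
    have h₁ : haltList (machine (N + 1) p) (List.map (Equiv.refl Bool).invFun (eb (f a))) =
        ⟨none, none,
          fun i : Fin (N + 1 + 1) => Function.update (fun _ => []) 1 (eb (f a)) (i : ℕ)⟩ := by
      refine congrArg (TM2.Cfg.mk _ _) (funext fun i : Fin (N + 1 + 1) => ?_)
      by_cases hi : i = Fin.ofNat (N + 1 + 1) 1
      · subst hi
        exact (dif_pos rfl).trans (List.map_id _)
      · have hi' : (i : ℕ) ≠ 1 := fun h => hi (Fin.ext (by rw [h]; simp))
        exact (dif_neg hi).trans (Function.update_of_ne hi' _ fun _ => []).symm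
    rw [Option.map_some, h₁, h₀]
    exact (congrArg _ hv).trans rfl
  · simp only [Polynomial.eval_add, Polynomial.eval_one]
    omega

end StackProg

/-! ### Stack macros with explicit time bounds -/

namespace StackProg

/-- `p` transforms the stacks `s` into `s'` in at most `T` steps. -/
def RunsIn (p : StackProg) (s s' : ℕ → List Bool) (T : ℕ) : Prop :=
  ∃ t ≤ T, Runs p s s' t

namespace RunsIn

variable {p q : StackProg} {s s' s'' : ℕ → List Bool} {k T U : ℕ}

theorem mono (h : RunsIn p s s' T) (hs : s' = s'') (hT : T ≤ U) : RunsIn p s s'' U := by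
  obtain ⟨t, ht, hr⟩ := h
  exact ⟨t, ht.trans hT, hs ▸ hr⟩

theorem of_eq (h : RunsIn p s' s'' T) (hs : s = s') : RunsIn p s s'' T := hs ▸ h

theorem skip (s) : RunsIn skip s s 1 := ⟨1, le_rfl, .skip s⟩

theorem push (s) (k : ℕ) (b : Bool) : RunsIn (push k b) s (Function.update s k (b :: s k)) 1 :=
  ⟨1, le_rfl, .push s k b⟩

theorem pop (s) (k : ℕ) : RunsIn (pop k) s (Function.update s k (s k).tail) 1 :=
  ⟨1, le_rfl, .pop s k⟩

theorem seq (hp : RunsIn p s s' T) (hq : RunsIn q s' s'' U) : RunsIn (seq p q) s s'' (T + U) := by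
  obtain ⟨t, ht, hp⟩ := hp
  obtain ⟨u, hu, hq⟩ := hq
  exact ⟨t + u, by omega, .seq hp hq⟩

theorem ite_true (hk : (s k).head? = some true) (hp : RunsIn p s s' T) :
    RunsIn (ite k p q) s s' (1 + T) := by
  obtain ⟨t, ht, hp⟩ := hp
  exact ⟨1 + t, by omega, .ite_true hk hp⟩

theorem ite_false (hk : (s k).head? ≠ some true) (hq : RunsIn q s s' T) :
    RunsIn (ite k p q) s s' (1 + T) := by
  obtain ⟨t, ht, hq⟩ := hq
  exact ⟨1 + t, by omega, .ite_false hk hq⟩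

theorem loop_nil (hk : s k = []) : RunsIn (loop k p) s s 1 := ⟨1, le_rfl, .loop_nil hk⟩

theorem loop_cons (hk : s k ≠ []) (hp : RunsIn p s s' T) (hl : RunsIn (loop k p) s' s'' U) :
    RunsIn (loop k p) s s'' (1 + (T + U)) := by
  obtain ⟨t, ht, hp⟩ := hp
  obtain ⟨u, hu, hl⟩ := hl
  exact ⟨1 + (t + u), by omega, .loop_cons hk hp hl⟩

end RunsIn

open Function

/-- Empty stack `a`. -/
def clear (a : ℕ) : StackProg := loop a (pop a)

/-- Move the content of stack `a`, reversed, onto stack `b`. -/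
def move (a b : ℕ) : StackProg := loop a (seq (ite a (push b true) (push b false)) (pop a))

/-- Move the content of stack `a` onto stack `b`, using the empty stack `c`. -/
def transfer (a b c : ℕ) : StackProg := seq (move a c) (move c b)

/-- Copy the content of stack `a` onto stack `b`, using the empty stack `c`. -/
def copy (a b c : ℕ) : StackProg :=
  seq (move a c) (loop c (seq (ite c (seq (push a true) (push b true))
    (seq (push a false) (push b false))) (pop c)))

theorem runsIn_clear (a : ℕ) (s : ℕ → List Bool) :
    RunsIn (clear a) s (update s a []) (2 * (s a).length + 1) := by
  generalize hw : s a = w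
  induction w generalizing s with
  | nil => exact (RunsIn.loop_nil hw).mono (by rw [← hw, update_eq_self]) le_rfl
  | cons b w ih =>
    refine (RunsIn.loop_cons (by simp [hw]) (.pop s a) (ih _ (by simp [hw]))).mono (by simp) ?_
    simp only [List.length_cons]; omega

theorem runsIn_move {a b : ℕ} (hab : a ≠ b) (s : ℕ → List Bool) :
    RunsIn (move a b) s (update (update s a []) b ((s a).reverse ++ s b))
      (4 * (s a).length + 1) := by
  generalize hw : s a = w
  induction w generalizing s with
  | nil =>
    refine (RunsIn.loop_nil hw).mono ?_ le_rfl
    funext i; simp only [update_apply]; split_ifs <;> simp_all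
  | cons x w ih =>
    have h₁ : RunsIn (ite a (push b true) (push b false)) s (update s b (x :: s b)) 2 := by
      cases x
      · exact .ite_false (by simp [hw]) (.push s b false)
      · exact .ite_true (by simp [hw]) (.push s b true)
    refine (RunsIn.loop_cons (by simp [hw]) (h₁.seq (.pop _ a)) (ih _ ?_)).mono ?_ ?_
    · simp [hab, hw]
    · funext i; simp only [update_apply]; split_ifs <;> simp_all
    · simp only [List.length_cons]; omega

theorem runsIn_transfer {a b c : ℕ} (hab : a ≠ b) (hac : a ≠ c) (hbc : b ≠ c)
    (s : ℕ → List Bool) (hc : s c = []) :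
    RunsIn (transfer a b c) s (update (update s a []) b (s a ++ s b))
      (8 * (s a).length + 2) := by
  refine ((runsIn_move hac s).seq (runsIn_move hbc.symm _)).mono ?_ ?_
  · funext i; simp only [update_apply]; split_ifs <;> simp_all
  · simp [hc]; omega

/-- Moving `a` to `c` reverses it; the second loop reverses again while writing to `a` and `b`
simultaneously, so both receive the original order. -/
theorem runsIn_copy {a b c : ℕ} (hab : a ≠ b) (hac : a ≠ c) (hbc : b ≠ c)
    (s : ℕ → List Bool) (hc : s c = []) :
    RunsIn (copy a b c) s (update s b (s a ++ s b)) (9 * (s a).length + 2) := by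
  have key : ∀ (w : List Bool) (s : ℕ → List Bool), s c = w →
      RunsIn (loop c (seq (ite c (seq (push a true) (push b true))
        (seq (push a false) (push b false))) (pop c))) s
        (update (update (update s c []) a (w.reverse ++ s a)) b (w.reverse ++ s b))
        (5 * w.length + 1) := by
    intro w
    induction w with
    | nil =>
      intro s hw
      refine (RunsIn.loop_nil hw).mono ?_ le_rfl
      funext i; simp only [update_apply]; split_ifs <;> simp_all
    | cons x w ih =>
      intro s hw
      have h₁ : RunsIn (ite c (seq (push a true) (push b true))
          (seq (push a false) (push b false))) s
          (update (update s a (x :: s a)) b (x :: s b)) 3 := by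
        cases x
        · refine .ite_false (by simp [hw]) (((RunsIn.push s a false).seq (.push _ b false)).mono ?_
            le_rfl)
          simp [hab.symm]
        · refine .ite_true (by simp [hw]) (((RunsIn.push s a true).seq (.push _ b true)).mono ?_
            le_rfl)
          simp [hab.symm]
      refine (RunsIn.loop_cons (by simp [hw]) (h₁.seq (.pop _ c)) (ih _ ?_)).mono ?_ ?_
      · simp [hac.symm, hbc.symm, hw]
      · funext i; simp only [update_apply]; split_ifs <;> simp_all
      · simp only [List.length_cons]; omega
  refine ((runsIn_move hac s).seq (key _ _ rfl)).mono ?_ ?_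
  · funext i; simp only [update_apply]; split_ifs <;> simp_all
  · simp [hc]; omega

end StackProg

/-! ### Functions computed in polynomial time, compositionally -/

/-- A type whose elements are represented by a string of bits. -/
class Reg (β : Type) where
  toReg : β → List Bool

/-- A type whose elements are represented by a list of strings of bits. -/
class Regs (α : Type) where
  regs : α → List (List Bool)

instance {α β : Type} [Regs α] [Reg β] : Regs (α × β) :=
  ⟨fun c => Reg.toReg c.2 :: Regs.regs c.1⟩

instance : Reg (List Bool) := ⟨id⟩

instance : Reg Bool := ⟨fun b => [b]⟩

instance : Reg ℕ := ⟨fun n => List.replicate n true⟩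

instance : Reg (List ℕ) := ⟨encodeNats⟩

/-- The total length of the strings representing an element. -/
def Regs.size {α : Type} [Regs α] (a : α) : ℕ := ((Regs.regs a).map List.length).sum

open Reg Regs

/-- `t` is bounded by a polynomial in the size of the argument. -/
def PolyBdd {α : Type} [Regs α] (t : α → ℕ) : Prop :=
  ∃ P : Polynomial ℕ, ∀ a, t a ≤ P.eval (size a)

/-- The coefficients are natural numbers. Monotonicity is what allows polynomial bounds to be
substituted into each other. -/
theorem Polynomial.eval_nat_mono (P : Polynomial ℕ) : Monotone fun n => P.eval n := by
  intro m n h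
  simp only [Polynomial.eval_eq_sum_range]
  exact Finset.sum_le_sum fun i _ => Nat.mul_le_mul_left _ (Nat.pow_le_pow_left h i)

namespace PolyBdd

variable {α β : Type} [Regs α] [Regs β] {t u : α → ℕ}

theorem mono (ht : PolyBdd t) (h : ∀ a, u a ≤ t a) : PolyBdd u := by
  obtain ⟨P, hP⟩ := ht
  exact ⟨P, fun a => (h a).trans (hP a)⟩

theorem const (c : ℕ) : PolyBdd fun _ : α => c :=
  ⟨Polynomial.C c, fun a => by simp⟩

theorem size : PolyBdd fun a : α => Regs.size a :=
  ⟨Polynomial.X, fun a => by simp⟩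

theorem add (ht : PolyBdd t) (hu : PolyBdd u) : PolyBdd fun a => t a + u a := by
  obtain ⟨P, hP⟩ := ht
  obtain ⟨Q, hQ⟩ := hu
  exact ⟨P + Q, fun a => by rw [Polynomial.eval_add]; exact add_le_add (hP a) (hQ a)⟩

theorem mul (ht : PolyBdd t) (hu : PolyBdd u) : PolyBdd fun a => t a * u a := by
  obtain ⟨P, hP⟩ := ht
  obtain ⟨Q, hQ⟩ := hu
  exact ⟨P * Q, fun a => by rw [Polynomial.eval_mul]; exact Nat.mul_le_mul (hP a) (hQ a)⟩

theorem eval (P : Polynomial ℕ) (ht : PolyBdd t) : PolyBdd fun a => P.eval (t a) := by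
  obtain ⟨Q, hQ⟩ := ht
  exact ⟨P.comp Q, fun a => by
    rw [Polynomial.eval_comp]; exact Polynomial.eval_nat_mono P (hQ a)⟩

theorem comp {v : β → ℕ} (hv : PolyBdd v) {φ : α → β} (hφ : PolyBdd fun a => Regs.size (φ a)) :
    PolyBdd fun a => v (φ a) := by
  obtain ⟨P, hP⟩ := hv
  exact (hφ.eval P).mono fun a => hP (φ a)

end PolyBdd

/-- The variables `r` are found in the stacks `loc 0, loc 1, …` below `k`, and the stacks from `k`
on are empty. -/
structure Realizes (s : ℕ → List Bool) (k : ℕ) (loc : ℕ → ℕ) (r : List (List Bool)) : Prop where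
  lt : ∀ i x, r[i]? = some x → loc i < k
  val : ∀ i x, r[i]? = some x → s (loc i) = x
  free : ∀ j, k ≤ j → s j = []

/-- Add the stack `k` as variable `0`. -/
def extendLoc (k : ℕ) (loc : ℕ → ℕ) : ℕ → ℕ
  | 0 => k
  | i + 1 => loc i

namespace Realizes

open Function

variable {s : ℕ → List Bool} {k : ℕ} {loc : ℕ → ℕ} {r : List (List Bool)}

theorem raise (h : Realizes s k loc r) (w : List Bool) :
    Realizes (update s k w) (k + 1) loc r where
  lt i x hx := (h.lt i x hx).trans (Nat.lt_succ_self k)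
  val i x hx := by rw [update_of_ne (h.lt i x hx).ne, h.val i x hx]
  free j hj := by rw [update_of_ne (by omega), h.free j (by omega)]

theorem extend (h : Realizes s k loc r) (w : List Bool) :
    Realizes (update s k w) (k + 1) (extendLoc k loc) (w :: r) where
  lt i x hx := by
    cases i with
    | zero => exact Nat.lt_succ_self k
    | succ i => exact (h.raise w).lt i x hx
  val i x hx := by
    cases i with
    | zero => simpa [extendLoc] using hx
    | succ i => exact (h.raise w).val i x hx
  free := (h.raise w).free

end Realizes

/-- `f` is computed in polynomial time by programs that find the argument in given stacks, leave
the value in the first free stack, and restore all other stacks. -/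
def PT {α β : Type} [Regs α] [Reg β] (f : α → β) : Prop :=
  PolyBdd (fun a => (toReg (f a)).length) ∧
  ∃ (p : ℕ → (ℕ → ℕ) → StackProg) (T : α → ℕ), PolyBdd T ∧
    ∀ a k loc s, Realizes s k loc (regs a) →
      (p k loc).RunsIn s (Function.update s k (toReg (f a))) (T a)

namespace PT

open Function StackProg

variable {α β γ δ : Type} [Regs α] [Reg β] [Reg γ] [Reg δ]

/-- Programs only see bits, so a value may be reinterpreted in another type with the same
representation. -/
theorem of_toReg {f : α → β} {g : α → γ} (hf : PT f) (h : ∀ a, toReg (g a) = toReg (f a)) :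
    PT g := by
  obtain ⟨hb, p, T, hT, hp⟩ := hf
  exact ⟨hb.mono fun a => by rw [h], p, T, hT, fun a => by rw [h]; exact hp a⟩

theorem congr {f g : α → β} (hf : PT f) (h : ∀ a, g a = f a) : PT g :=
  hf.of_toReg fun a => congrArg _ (h a)

theorem var {f : α → β} (i : ℕ) (h : ∀ a, (regs a)[i]? = some (toReg (f a))) : PT f := by
  have hb : PolyBdd fun a => (toReg (f a)).length := PolyBdd.size.mono fun a =>
    List.single_le_sum (by simp) _ (List.mem_map_of_mem (List.mem_of_getElem? (h a)))
  refine ⟨hb, fun k loc => copy (loc i) k (k + 1), _,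
    ((PolyBdd.const 9).mul hb).add (.const 2), fun a k loc s hs => ?_⟩
  have hlt := hs.lt _ _ (h a)
  refine (runsIn_copy hlt.ne (by omega) (by omega) s (hs.free _ (by omega))).mono ?_ ?_
  · rw [hs.val _ _ (h a), hs.free k le_rfl, List.append_nil]
  · rw [hs.val _ _ (h a)]

theorem snd : PT fun c : α × β => c.2 := var 0 fun _ => rfl

/-- A change of context moves no data: the same program is run with the variables looked up through
`loc ∘ ρ`. -/
theorem rename {α' : Type} [Regs α'] {f : α → β} (hf : PT f) {φ : α' → α} (ρ : ℕ → ℕ)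
    (hφ : PolyBdd fun a => size (φ a))
    (hρ : ∀ a i x, (regs (φ a))[i]? = some x → (regs a)[ρ i]? = some x) :
    PT fun a => f (φ a) := by
  obtain ⟨hb, p, T, hT, hp⟩ := hf
  refine ⟨hb.comp hφ, fun k loc => p k (loc ∘ ρ), _, hT.comp hφ, fun a k loc s hs => ?_⟩
  exact hp (φ a) k _ s ⟨fun i x hx => hs.lt _ x (hρ a i x hx),
    fun i x hx => hs.val _ x (hρ a i x hx), hs.free⟩

theorem weaken {f : α → β} (hf : PT f) : PT fun c : α × γ => f c.1 :=
  hf.rename Nat.succ (PolyBdd.size.mono fun c => by simp [size, regs]) fun c i x hx => hx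

theorem nil {g : α → β} (h : ∀ a, toReg (g a) = []) : PT g := by
  refine ⟨(PolyBdd.const 0).mono (by simp [h]), fun _ _ => skip, _, .const 1,
    fun a k loc s hs => (RunsIn.skip s).mono ?_ le_rfl⟩
  rw [h, ← hs.free k le_rfl, update_eq_self]

theorem cons_bit {f : α → β} (hf : PT f) {g : α → γ} (b : Bool)
    (h : ∀ a, toReg (g a) = b :: toReg (f a)) : PT g := by
  obtain ⟨hb, p, T, hT, hp⟩ := hf
  refine ⟨(hb.add (.const 1)).mono (by simp [h]), fun k loc => seq (p k loc) (push k b), _,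
    hT.add (.const 1), fun a k loc s hs => ((hp a k loc s hs).seq (.push _ k b)).mono ?_ le_rfl⟩
  simp [h]

theorem tail_bit {f : α → β} (hf : PT f) {g : α → γ}
    (h : ∀ a, toReg (g a) = (toReg (f a)).tail) : PT g := by
  obtain ⟨hb, p, T, hT, hp⟩ := hf
  refine ⟨hb.mono (by simp [h]), fun k loc => seq (p k loc) (pop k), _,
    hT.add (.const 1), fun a k loc s hs => ((hp a k loc s hs).seq (.pop _ k)).mono ?_ le_rfl⟩
  simp [h]

theorem const (b : β) : PT fun _ : α => b := by
  have : ∀ w : List Bool, PT fun _ : α => w := by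
    intro w
    induction w with
    | nil => exact nil fun _ => rfl
    | cons x w ih => exact ih.cons_bit x fun _ => rfl
  exact (this (toReg b)).of_toReg fun _ => rfl

/-- Case distinction on the first bit of a value. -/
theorem ite_head {c : α → δ} (hc : PT c) {f g : α → β} (hf : PT f) (hg : PT g)
    {P : α → Prop} [DecidablePred P] (hP : ∀ a, P a ↔ (toReg (c a)).head? = some true) :
    PT fun a => if P a then f a else g a := by
  obtain ⟨hbc, pc, Tc, hTc, hpc⟩ := hc
  obtain ⟨hbf, pf, Tf, hTf, hpf⟩ := hf
  obtain ⟨hbg, pg, Tg, hTg, hpg⟩ := hg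
  refine ⟨(hbf.add hbg).mono fun a => by dsimp only; split_ifs <;> omega, fun k loc =>
    seq (pc k loc) (ite k (seq (clear k) (pf k loc)) (seq (clear k) (pg k loc))), _,
    hTc.add ((PolyBdd.const 1).add ((((PolyBdd.const 2).mul hbc).add (.const 1)).add
      (hTf.add hTg))), fun a k loc s hs => ?_⟩
  have hk : update s k [] = s := by rw [← hs.free k le_rfl, update_eq_self]
  have hcl := (runsIn_clear k (update s k (toReg (c a)))).mono
    (by rw [update_idem, hk]) le_rfl
  rw [update_self] at hcl
  refine (hpc a k loc s hs).seq ?_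
  dsimp only
  by_cases h : P a
  · rw [if_pos h]
    exact (RunsIn.ite_true (by simpa using (hP a).1 h) (hcl.seq (hpf a k loc s hs))).mono rfl
      (by omega)
  · rw [if_neg h]
    exact (RunsIn.ite_false (by simpa using mt (hP a).2 h) (hcl.seq (hpg a k loc s hs))).mono rfl
      (by omega)

theorem length_toReg {f : α → β} (hf : PT f) : PT fun a => (toReg (f a)).length := by
  obtain ⟨hb, p, T, hT, hp⟩ := hf
  have key : ∀ (k : ℕ) (w : List Bool) (s : ℕ → List Bool), s k = w →
      RunsIn (loop k (seq (push (k + 1) true) (pop k))) s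
        (update (update s k []) (k + 1) (List.replicate w.length true ++ s (k + 1)))
        (3 * w.length + 1) := by
    intro k w
    induction w with
    | nil =>
      intro s hw
      refine (RunsIn.loop_nil hw).mono ?_ le_rfl
      funext i; simp only [update_apply]; split_ifs <;> simp_all
    | cons x w ih =>
      intro s hw
      refine (RunsIn.loop_cons (by simp [hw]) ((RunsIn.push s (k + 1) true).seq (.pop _ k))
        (ih _ ?_)).mono ?_ ?_
      · simp [hw]
      · have hr : List.replicate (w.length + 1) true ++ s (k + 1) =
            List.replicate w.length true ++ true :: s (k + 1) := by
          rw [List.replicate_succ', List.append_assoc]; rfl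
        clear ih
        funext i; simp only [update_apply]; split_ifs <;> first | omega | rfl | exact hr.symm
      · simp only [List.length_cons]; omega
  refine ⟨hb.mono fun a => by simp [toReg], fun k loc => seq (p k loc)
    (seq (loop k (seq (push (k + 1) true) (pop k))) (move (k + 1) k)), _,
    hT.add ((((PolyBdd.const 3).mul hb).add (.const 1)).add (((PolyBdd.const 4).mul hb).add
      (.const 1))), fun a k loc s hs => ?_⟩
  have h₁ := hs.free (k + 1) (by omega)
  refine ((hp a k loc s hs).seq ((key k _ _ rfl).seq (runsIn_move (by omega) _))).mono ?_ ?_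
  · clear key hp
    funext i; simp only [update_apply]; split_ifs <;> first | omega | rfl | simp [*, toReg]
  · simp [h₁]

/-- Iteration over a number: the `j`-th step may use `j`, the number of remaining steps, and the
current value, whose length has to be polynomially bounded. -/
theorem iterate {n : α → ℕ} (hn : PT n) {init : α → γ} (hi : PT init)
    {body : ((α × ℕ) × ℕ) × γ → γ} (hb : PT body) (F : α → ℕ → γ) (h0 : ∀ a, F a 0 = init a)
    (hF : ∀ a j, j < n a → F a (j + 1) = body (((a, n a - (j + 1)), j), F a j))
    {B : α → ℕ} (hB : PolyBdd B) (hFB : ∀ a j, j ≤ n a → (toReg (F a j)).length ≤ B a) :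
    PT fun a => F a (n a) := by
  obtain ⟨hbn, pn, Tn, hTn, hpn⟩ := hn
  obtain ⟨-, pi, Ti, hTi, hpi⟩ := hi
  obtain ⟨-, p, T, ⟨P, hP⟩, hp⟩ := hb
  have hbn' : PolyBdd n := hbn.mono fun a => by simp [toReg]
  -- Layout: `k` holds the remaining steps, `k + 1` the index, `k + 2` the current value, `k + 3`
  -- receives the new value, and `k + 4` is scratch for the transfer.
  let iter (k : ℕ) (loc : ℕ → ℕ) : StackProg :=
    seq (pop k) (seq (p (k + 3) (extendLoc (k + 2) (extendLoc (k + 1) (extendLoc k loc))))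
      (seq (clear (k + 2)) (seq (transfer (k + 3) (k + 2) (k + 4)) (push (k + 1) true))))
  let C (a : α) : ℕ := 1 + (P.eval (size a + n a + n a + B a) + ((2 * B a + 1) +
    ((8 * B a + 2) + 1)))
  let st (a : α) (k : ℕ) (s : ℕ → List Bool) (j : ℕ) : ℕ → List Bool :=
    update (update (update s k (toReg (n a - j))) (k + 1) (toReg j)) (k + 2) (toReg (F a j))
  have hC : PolyBdd C := (PolyBdd.const 1).add (((((PolyBdd.size.add hbn').add hbn').add
    hB).eval P).add ((((PolyBdd.const 2).mul hB).add (.const 1)).add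
    ((((PolyBdd.const 8).mul hB).add (.const 2)).add (.const 1))))
  have hiter : ∀ a k loc s, Realizes s k loc (regs a) → ∀ j < n a,
      RunsIn (iter k loc) (st a k s j) (st a k s (j + 1)) (C a) := by
    intro a k loc s hs j hj
    have h₃ := hs.free (k + 3) (by omega)
    have h₄ := hs.free (k + 4) (by omega)
    have hr : Realizes (update (st a k s j) k (toReg (n a - (j + 1)))) (k + 3)
        (extendLoc (k + 2) (extendLoc (k + 1) (extendLoc k loc)))
        (regs (((a, n a - (j + 1)), j), F a j)) := by
      have := ((hs.extend (toReg (n a - (j + 1)))).extend (toReg j)).extend (toReg (F a j))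
      refine Eq.subst (motive := fun s' => Realizes s' _ _ _) ?_ this
      clear hp hP hpi hpn
      funext i; simp only [st, update_apply]; split_ifs <;> first | rfl | omega
    have htail : (toReg (n a - j)).tail = toReg (n a - (j + 1)) := by
      simp [toReg, Nat.sub_sub]
    refine ((RunsIn.pop _ k).seq (RunsIn.seq (s' := update (update (st a k s j) k
      (toReg (n a - (j + 1)))) (k + 3) (toReg (F a (j + 1)))) (T := P.eval (size a + n a + n a +
      B a)) ?_ ((runsIn_clear (k + 2) _).seq ((runsIn_transfer (by omega) (by omega) (by omega) _
      ?_).seq (.push _ (k + 1) true))))).mono ?_ ?_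
    · rw [hF a j hj]
      -- The bound `B`, uniform in `j`, keeps the cost of each round polynomial; bounding the body
      -- alone would allow lengths to compound.
      refine ((hp _ _ _ _ hr).mono rfl ((hP _).trans (Polynomial.eval_nat_mono P ?_))).of_eq ?_
      · have := hFB a j hj.le
        simp only [size, regs, List.map_cons, List.sum_cons] at this ⊢
        simp only [toReg, List.length_replicate] at this ⊢
        omega
      · simp [st, htail]
    · simp [st, h₄]
    · funext i; simp only [st, update_apply]
      split_ifs <;> simp_all [toReg, List.replicate_succ]
    · have := hFB a j hj.le
      have := hFB a (j + 1) hj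
      simp [st, C]
      omega
  have hloop : ∀ a k loc s, Realizes s k loc (regs a) → ∀ m j, j + m = n a →
      RunsIn (loop k (iter k loc)) (st a k s j) (st a k s (n a)) (m * (C a + 1) + 1) := by
    intro a k loc s hs m
    induction m with
    | zero =>
      intro j hj
      obtain rfl : j = n a := by omega
      exact (RunsIn.loop_nil (by simp [st, toReg])).mono rfl (by omega)
    | succ m ih =>
      intro j hj
      refine (RunsIn.loop_cons ?_ (hiter a k loc s hs j (by omega)) (ih (j + 1) (by omega))).mono
        rfl (by linarith)
      have : n a - j ≠ 0 := by omega
      simpa [st, toReg] using this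
  refine ⟨hB.mono fun a => hFB a _ le_rfl, fun k loc => seq (pn k loc) (seq (pi (k + 2) loc)
    (seq (loop k (iter k loc)) (seq (clear (k + 1)) (transfer (k + 2) k (k + 3))))), _,
    hTn.add (hTi.add (((hbn'.mul (hC.add (.const 1))).add (.const 1)).add
      ((((PolyBdd.const 2).mul hbn').add (.const 1)).add (((PolyBdd.const 8).mul hB).add
      (.const 2))))), fun a k loc s hs => ?_⟩
  have h₀ := hs.free k le_rfl
  have h₁ := hs.free (k + 1) (by omega)
  have h₂ := hs.free (k + 2) (by omega)
  have h₃ := hs.free (k + 3) (by omega)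
  have hr : Realizes (update s k (toReg (n a))) (k + 2) loc (regs a) := by
    -- The index starts at `0`, whose unary code is empty, so stack `k + 1` is reserved without
    -- being written.
    have := (hs.raise (toReg (n a))).raise []
    rwa [update_eq_self_iff.2 (by simp [h₁])] at this
  refine ((hpn a k loc s hs).seq ((hpi a _ _ _ hr).seq (((hloop a k loc s hs (n a) 0
    (by omega)).of_eq ?_).seq ((runsIn_clear (k + 1) _).seq (runsIn_transfer (by omega) (by omega)
    (by omega) _ ?_))))).mono ?_ ?_
  · rw [← h0]
    clear hloop hiter hp hP hpi hpn hFB hF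
    funext i; simp only [st, update_apply]; split_ifs <;> simp_all [toReg]
  · simp [st, h₃]
  · clear hloop hiter hp hP hpi hpn hFB hF h0
    funext i; simp only [st, update_apply]; split_ifs <;> first | omega | rfl | simp [*, toReg]
  · have := hFB a (n a) le_rfl
    simp [st, toReg] at this ⊢
    omega

/-- A function computed in polynomial time in the compositional sense is computed by a Turing
machine in polynomial time. -/
theorem computableInPolyTime {ea : α → List Bool} (hea : ∀ a, regs a = [ea a]) {f : α → β}
    (hf : PT f) : Nonempty (TM2ComputableInPolyTime ea toReg f) := by
  obtain ⟨-, p, T, ⟨P, hP⟩, hp⟩ := hf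
  -- With the input as the only variable on stack `0`, the first free stack is `1`, the output
  -- stack; only the input remains to be erased.
  refine StackProg.computableInPolyTime (seq (p 1 id) (clear 0)) (P + 2 * .X + 1) fun a => ?_
  have hsize : size a = (ea a).length := by simp [size, hea]
  refine ((hp a 1 id (update (fun _ => []) 0 (ea a)) ?_).seq (runsIn_clear 0 _)).mono ?_ ?_
  · rw [hea]
    refine ⟨fun i x hx => ?_, fun i x hx => ?_, fun j hj => ?_⟩
    · cases i <;> simp_all
    · cases i <;> simp_all
    · exact update_of_ne (by omega) _ _
  · funext i; simp only [update_apply]; split_ifs <;> simp_all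
  · have := hP a
    rw [hsize] at this
    simp
    omega

end PT

theorem encodeNats_nil : encodeNats [] = [] := rfl

theorem encodeNats_cons (x : ℕ) (l : List ℕ) :
    encodeNats (x :: l) = List.replicate x true ++ false :: encodeNats l := by
  simp [encodeNats]

theorem encodeNats_append (l l' : List ℕ) :
    encodeNats (l ++ l') = encodeNats l ++ encodeNats l' :=
  List.flatMap_append

/-! ### Unary arithmetic and bounded search -/

namespace PT

variable {α β γ δ : Type} [Regs α] [Reg β] [Reg γ] [Reg δ]

theorem bdd {n : α → ℕ} (hn : PT n) : PolyBdd n := hn.1.mono fun a => by simp [toReg]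

theorem ite {c : α → Bool} (hc : PT c) {f g : α → β} (hf : PT f) (hg : PT g) :
    PT fun a => if c a then f a else g a :=
  hc.ite_head hf hg fun a => by simp [toReg]

theorem ite_pos {n : α → ℕ} (hn : PT n) {f g : α → β} (hf : PT f) (hg : PT g) :
    PT fun a => if 0 < n a then f a else g a :=
  hn.ite_head hf hg fun a => by cases n a <;> simp [toReg, List.replicate_succ]

theorem and {b c : α → Bool} (hb : PT b) (hc : PT c) : PT fun a => b a && c a :=
  (hb.ite hc (const false)).congr fun a => by cases b a <;> rfl

theorem or {b c : α → Bool} (hb : PT b) (hc : PT c) : PT fun a => b a || c a :=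
  (hb.ite (const true) hc).congr fun a => by cases b a <;> rfl

theorem succ {n : α → ℕ} (hn : PT n) : PT fun a => n a + 1 :=
  hn.cons_bit true fun _ => List.replicate_succ

theorem pred {n : α → ℕ} (hn : PT n) : PT fun a => n a - 1 :=
  hn.tail_bit fun _ => by simp [toReg]

/-! In the body of an iteration the context consists of the outer context, the number of remaining
steps, the index and the current value. -/

theorem outer {f : α → β} (hf : PT f) : PT fun c : ((α × ℕ) × ℕ) × γ => f c.1.1.1 :=
  hf.weaken.weaken.weaken

theorem rest {f : α → ℕ → β} (hf : PT fun c : α × ℕ => f c.1 c.2) :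
    PT fun c : ((α × ℕ) × ℕ) × γ => f c.1.1.1 c.1.1.2 :=
  hf.weaken.weaken

/-- Variables are listed innermost first: current value `0`, index `1`, remaining steps `2`, outer
context from `3` on. -/
theorem index {f : α → ℕ → β} (hf : PT fun c : α × ℕ => f c.1 c.2) :
    PT fun c : ((α × ℕ) × ℕ) × γ => f c.1.1.1 c.1.2 :=
  hf.rename (φ := fun c : ((α × ℕ) × ℕ) × γ => (c.1.1.1, c.1.2)) (fun i => Nat.casesOn i 1 (· + 3))
    (PolyBdd.size.mono fun c => by simp [size, regs]; omega)
    fun c i x hx => by cases i <;> simpa [regs] using hx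

theorem current {f : α → γ → β} (hf : PT fun c : α × γ => f c.1 c.2) :
    PT fun c : ((α × ℕ) × ℕ) × γ => f c.1.1.1 c.2 :=
  hf.rename (φ := fun c : ((α × ℕ) × ℕ) × γ => (c.1.1.1, c.2)) (fun i => Nat.casesOn i 0 (· + 3))
    (PolyBdd.size.mono fun c => by simp [size, regs]; omega)
    fun c i x hx => by cases i <;> simpa [regs] using hx

theorem add {m n : α → ℕ} (hm : PT m) (hn : PT n) : PT fun a => m a + n a :=
  iterate hn hm snd.succ (fun a j => m a + j) (fun _ => rfl) (fun _ _ _ => rfl)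
    (hm.bdd.add hn.bdd) fun a j hj => by simpa [toReg] using hj

theorem mul {m n : α → ℕ} (hm : PT m) (hn : PT n) : PT fun a => m a * n a :=
  iterate hn (const 0) (snd.add (outer hm)) (fun a j => m a * j) (fun _ => rfl)
    (fun _ _ _ => Nat.mul_succ _ _) (hm.bdd.mul hn.bdd)
    fun a j hj => by simpa [toReg] using Nat.mul_le_mul_left _ hj

theorem sub {m n : α → ℕ} (hm : PT m) (hn : PT n) : PT fun a => m a - n a :=
  iterate hn hm snd.pred (fun a j => m a - j) (fun _ => rfl) (fun _ _ _ => rfl)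
    hm.bdd fun a j hj => by simp [toReg]

theorem lt {m n : α → ℕ} (hm : PT m) (hn : PT n) : PT fun a => decide (m a < n a) :=
  ((hn.sub hm).ite_pos (const true) (const false)).congr fun a => by
    simp only [Nat.sub_pos_iff_lt]; split_ifs <;> simp_all

theorem le {m n : α → ℕ} (hm : PT m) (hn : PT n) : PT fun a => decide (m a ≤ n a) :=
  (hm.lt hn.succ).congr fun a => by simp

/-- The quotient is found by counting up while the next multiple of `d` still fits below `m`.
Positivity of `d` is tested because division by zero gives `0`, whereas multiples of zero always
fit. -/
theorem div {m d : α → ℕ} (hm : PT m) (hd : PT d) : PT fun a => m a / d a := by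
  have hbody : PT fun c : ((α × ℕ) × ℕ) × ℕ =>
      if (decide (0 < d c.1.1.1) && decide ((c.2 + 1) * d c.1.1.1 ≤ m c.1.1.1)) then c.2 + 1
      else c.2 :=
    (((const 0).lt hd.outer).and ((snd.succ.mul hd.outer).le hm.outer)).ite snd.succ snd
  refine (iterate hm (const 0) hbody (fun a j => min j (m a / d a)) (fun a => by simp) ?_
    hm.bdd fun a j hj => by simp [toReg, hj]).congr fun a => ?_
  · intro a j hj
    rcases Nat.eq_zero_or_pos (d a) with hd | hd
    · simp [hd]
    · simp only [hd, decide_true, Bool.true_and, decide_eq_true_eq, ← Nat.le_div_iff_mul_le hd]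
      split_ifs <;> omega
  · exact (min_eq_right (Nat.div_le_self _ _)).symm

theorem mod {m d : α → ℕ} (hm : PT m) (hd : PT d) : PT fun a => m a % d a :=
  (hm.sub (hd.mul (hm.div hd))).congr fun _ => Nat.mod_def _ _

theorem all_range {n : α → ℕ} (hn : PT n) {f : α → ℕ → Bool}
    (hf : PT fun c : α × ℕ => f c.1 c.2) : PT fun a => (List.range (n a)).all (f a) :=
  iterate hn (const true) (snd.and hf.index) (fun a j => (List.range j).all (f a))
    (fun _ => rfl) (fun a j _ => by simp [List.range_succ]) (.const 1) fun a j _ => le_rfl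

theorem any_range {n : α → ℕ} (hn : PT n) {f : α → ℕ → Bool}
    (hf : PT fun c : α × ℕ => f c.1 c.2) : PT fun a => (List.range (n a)).any (f a) :=
  iterate hn (const false) (snd.or hf.index) (fun a j => (List.range j).any (f a))
    (fun _ => rfl) (fun a j _ => by simp [List.range_succ]) (.const 1) fun a j _ => le_rfl

/-- One test per round suffices: the current value is either an index already found, where the test
succeeds and the value is kept, or the number of failures so far, which is the next index to try. -/
theorem findIdx_range {n : α → ℕ} (hn : PT n) {f : α → ℕ → Bool}
    (hf : PT fun c : α × ℕ => f c.1 c.2) : PT fun a => (List.range (n a)).findIdx (f a) := by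
  refine iterate hn (const 0) (hf.current.ite snd snd.succ)
    (fun a j => (List.range j).findIdx (f a)) (fun _ => rfl) ?_ hn.bdd ?_
  · intro a j _
    dsimp only
    rw [List.range_succ, List.findIdx_append, List.length_range]
    rcases (List.findIdx_le_length (xs := List.range j) (p := f a)).lt_or_eq with h | h
    · have h' := List.findIdx_getElem (w := h)
      rw [List.getElem_range] at h'
      rw [List.length_range] at h
      rw [if_pos h, if_pos h']
    · rw [List.length_range] at h
      rw [h, if_neg (lt_irrefl j), List.findIdx_singleton]
      split_ifs <;> simp [add_comm]
  · intro a j hj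
    have := List.findIdx_le_length (xs := List.range j) (p := f a)
    rw [List.length_range] at this
    simp only [toReg, List.length_replicate]
    omega

/-! ### Strings of bits -/

theorem drop_bits {f : α → β} (hf : PT f) {n : α → ℕ} (hn : PT n) {g : α → γ}
    (h : ∀ a, toReg (g a) = (toReg (f a)).drop (n a)) : PT g := by
  have hbody : PT fun c : ((α × ℕ) × ℕ) × List Bool => c.2.tail := snd.tail_bit fun _ => rfl
  have hf' : PT fun a => toReg (f a) := hf.of_toReg fun _ => rfl
  exact (iterate hn hf' hbody (fun a j => (toReg (f a)).drop j) (fun _ => rfl)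
    (fun a j _ => by simp) hf.1 fun a j _ => by simp [toReg]).of_toReg h

theorem getD_bits {f : α → β} (hf : PT f) {n : α → ℕ} (hn : PT n) :
    PT fun a => (toReg (f a)).getD (n a) false := by
  have h : PT fun a => (toReg (f a)).drop (n a) := hf.drop_bits hn fun _ => rfl
  refine (h.ite_head (const true) (const false)
    (P := fun a => (toReg (f a)).getD (n a) false = true) fun a => ?_).congr fun a => ?_
  · simp only [toReg, id, List.head?_drop, List.getD_eq_getElem?_getD]
    cases (toReg (f a))[n a]? <;> simp
  · split_ifs <;> simp_all

/-- Stacks grow at the head, so the bits of `f a` are prepended from last to first; the number of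
remaining steps is the position of the bit required. -/
theorem append_bits {f : α → β} (hf : PT f) {g : α → γ} (hg : PT g) {h : α → δ}
    (hh : ∀ a, toReg (h a) = toReg (f a) ++ toReg (g a)) : PT h := by
  have hg' : PT fun a => toReg (g a) := hg.of_toReg fun _ => rfl
  have hbit : PT fun c : α × ℕ => (toReg (f c.1)).getD c.2 false := hf.weaken.getD_bits snd
  have hbody : PT fun c : ((α × ℕ) × ℕ) × List Bool =>
      if (toReg (f c.1.1.1)).getD c.1.1.2 false then true :: c.2 else false :: c.2 :=
    (rest (f := fun a i => (toReg (f a)).getD i false) hbit).ite (snd.cons_bit true fun _ => rfl) (snd.cons_bit false fun _ => rfl)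
  refine (iterate hf.length_toReg hg' hbody
    (fun a j => (toReg (f a)).drop ((toReg (f a)).length - j) ++ toReg (g a)) (fun a => by simp)
    ?_ (hf.1.add hg.1) fun a j hj => by simp [toReg]).of_toReg fun a => ?_
  · intro a j hj
    have hlt : (toReg (f a)).length - (j + 1) < (toReg (f a)).length := by omega
    dsimp only
    rw [List.drop_eq_getElem_cons hlt, List.getD_eq_getElem _ _ hlt,
      show (toReg (f a)).length - (j + 1) + 1 = (toReg (f a)).length - j by omega]
    split_ifs with hb <;> simp [hb]
  · simp [hh, toReg]

/-- Concatenation over a range of indices, for any notion of concatenation. -/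
theorem flatMap_range_bits {n : α → ℕ} (hn : PT n) {f : α → ℕ → β}
    (hf : PT fun c : α × ℕ => f c.1 c.2) {g : α → γ}
    (hg : ∀ a, toReg (g a) = (List.range (n a)).flatMap fun i => toReg (f a i)) : PT g := by
  have hbody : PT fun c : ((α × ℕ) × ℕ) × List Bool => toReg (f c.1.1.1 c.1.1.2) ++ c.2 :=
    hf.rest.append_bits snd fun _ => rfl
  obtain ⟨P, hP⟩ := hf.1
  refine (iterate hn (const ([] : List Bool)) hbody
    (fun a j => (List.range' (n a - j) j).flatMap fun i => toReg (f a i)) (fun a => rfl) ?_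
    (hn.bdd.mul ((PolyBdd.size.add hn.bdd).eval P)) ?_).of_toReg fun a => ?_
  · intro a j hj
    rw [List.range'_succ, List.flatMap_cons, show n a - (j + 1) + 1 = n a - j by omega]
  · intro a j hj
    simp only [toReg, id, List.length_flatMap]
    refine (List.sum_le_card_nsmul _ (P.eval (size a + n a)) ?_).trans ?_
    · simp only [List.mem_map, List.mem_range'_1]
      rintro _ ⟨i, hi, rfl⟩
      refine (hP (a, i)).trans (Polynomial.eval_nat_mono P ?_)
      simp [size, regs, toReg] at *
      omega
    · simpa using Nat.mul_le_mul_right _ hj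
  · rw [hg, List.range_eq_range', Nat.sub_self]
    rfl

theorem map_range_bool {n : α → ℕ} (hn : PT n) {f : α → ℕ → Bool}
    (hf : PT fun c : α × ℕ => f c.1 c.2) : PT fun a => (List.range (n a)).map (f a) :=
  flatMap_range_bits hn hf fun a => by
    simp [toReg, List.map_eq_flatMap]

/-! ### Lists of numbers -/

/-- Subtract `j` from the first number of a list. -/
def subHead (j : ℕ) : List ℕ → List ℕ
  | [] => []
  | x :: l => (x - j) :: l

/-- Removing the leading bit of the code decrements the first number, unless that bit is the
delimiter of a zero, in which case nothing is removed. -/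
theorem subHead_one {l : α → List ℕ} (hl : PT l) : PT fun a => subHead 1 (l a) := by
  have h : PT fun a => (toReg (l a)).tail := hl.tail_bit fun _ => rfl
  have h' : PT fun a => toReg (l a) := hl.of_toReg fun _ => rfl
  refine (hl.ite_head h h' (P := fun a => 0 < (l a).headD 0) fun a => ?_).of_toReg fun a => ?_
  all_goals
    rcases l a with _ | ⟨_ | x, l⟩ <;>
      simp [toReg, encodeNats_nil, encodeNats_cons, subHead, List.replicate_succ]

/-- The length of the whole code is at least the first number, so that many decrements bring it to
zero; what remains of it is the delimiter, a single bit. -/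
theorem tail_nat {l : α → List ℕ} (hl : PT l) : PT fun a => (l a).tail := by
  refine (iterate hl.length_toReg hl (subHead_one snd) (fun a j => subHead j (l a)) (fun a => ?_)
    (fun a j _ => ?_) hl.1 fun a j _ => ?_).tail_bit fun a => ?_
  all_goals
    rcases l a with _ | ⟨x, l⟩ <;> simp [toReg, encodeNats_nil, encodeNats_cons, subHead]
  omega

theorem drop_nat {l : α → List ℕ} (hl : PT l) {n : α → ℕ} (hn : PT n) :
    PT fun a => (l a).drop (n a) :=
  iterate hn hl snd.tail_nat (fun a j => (l a).drop j) (fun _ => rfl) (fun a j _ => by simp) hl.1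
    fun a j _ => by
      have h := congrArg List.length (encodeNats_append ((l a).take j) ((l a).drop j))
      rw [List.take_append_drop, List.length_append] at h
      simp only [toReg]
      omega

theorem headD_nat {l : α → List ℕ} (hl : PT l) : PT fun a => (l a).headD 0 := by
  have hbody : PT fun c : ((α × ℕ) × ℕ) × ℕ =>
      if (toReg (l c.1.1.1)).getD c.2 false then c.2 + 1 else c.2 :=
    (hl.outer.getD_bits snd).ite snd.succ snd
  refine (iterate hl.length_toReg (const 0) hbody (fun a j => min j ((l a).headD 0))
    (fun a => by simp) (fun a j hj => ?_) hl.1 (fun a j hj => ?_)).congr fun a => ?_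
  · dsimp only
    rcases l a with _ | ⟨x, l⟩
    · simp [toReg, encodeNats_nil]
    · simp only [toReg, encodeNats_cons, List.headD_cons]
      rcases lt_or_ge j x with h | h
      · rw [min_eq_left h.le, min_eq_left h, List.getD_append _ _ _ _ (by simpa using h)]
        simp [List.getD_eq_getElem?_getD, h]
      · rw [min_eq_right h, min_eq_right (by omega), List.getD_append_right _ _ _ _ (by simp)]
        simp
  · simp only [toReg, List.length_replicate] at hj ⊢
    omega
  · rcases l a with _ | ⟨x, l⟩ <;> simp [toReg, encodeNats_nil, encodeNats_cons]

theorem getD_nat {l : α → List ℕ} (hl : PT l) {n : α → ℕ} (hn : PT n) :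
    PT fun a => (l a).getD (n a) 0 :=
  (hl.drop_nat hn).headD_nat.congr fun a => by
    simp [List.headD_eq_head?_getD, List.getD_eq_getElem?_getD]

theorem append_nat {l l' : α → List ℕ} (hl : PT l) (hl' : PT l') : PT fun a => l a ++ l' a :=
  hl.append_bits hl' fun _ => encodeNats_append _ _

theorem singleton_nat {n : α → ℕ} (hn : PT n) : PT fun a => [n a] :=
  hn.append_bits (const false) fun _ => by simp [toReg, encodeNats]

theorem flatMap_range_nat {n : α → ℕ} (hn : PT n) {f : α → ℕ → List ℕ}
    (hf : PT fun c : α × ℕ => f c.1 c.2) : PT fun a => (List.range (n a)).flatMap (f a) :=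
  flatMap_range_bits hn hf fun a => by simp [toReg, encodeNats, List.flatMap_assoc]

theorem map_range_nat {n : α → ℕ} (hn : PT n) {f : α → ℕ → ℕ}
    (hf : PT fun c : α × ℕ => f c.1 c.2) : PT fun a => (List.range (n a)).map (f a) :=
  (flatMap_range_nat hn (f := fun a i => [f a i]) hf.singleton_nat).congr fun _ =>
    List.map_eq_flatMap

end PT

/-! ### The safety game of an instance -/

/-- The word function of a strategy. -/
def strategyWord {α β : Type*} (f : List α → β) (x : List α) : List β := x.inits.tail.map f

theorem strategyWord_concat {α β : Type*} (f : List α → β) (x : List α) (a : α) :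
    strategyWord f (x ++ [a]) = strategyWord f x ++ [f (x ++ [a])] := by
  have h : (x ++ [a]).inits = x.inits ++ [x ++ [a]] := by simp [List.inits_append]
  have h' : x.inits ≠ [] := by cases x <;> simp
  rw [strategyWord, h, List.tail_append_of_ne_nil h', List.map_append]
  rfl

theorem length_strategyWord {α β : Type*} (f : List α → β) (x : List α) :
    (strategyWord f x).length = x.length := by
  simp [strategyWord]

theorem PartialDFA.evalFrom_append {α σ : Type*} (A : PartialDFA α σ) (s : σ) (v w : List α) :
    A.evalFrom s (v ++ w) = (A.evalFrom s v).bind fun t => A.evalFrom t w := by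
  induction v generalizing s with
  | nil => rfl
  | cons a v ih =>
    simp only [List.cons_append, PartialDFA.evalFrom, Option.bind_assoc, ih]

theorem Transducer.state_concat {α β σ : Type*} (T : Transducer α β σ) (w : List α) (a : α) :
    T.state (w ++ [a]) = T.step (T.state w) a := by
  simp [Transducer.state]

namespace HintInstance

variable (I : HintInstance)

/-- The positions of the game: states of the automaton paired with states of the hint. -/
abbrev Pos : Type := Fin I.nQ × Fin I.nP

/-- The position from which the game starts. -/
def startPos : I.Pos := (I.A.start, I.T₂.start)

/-- The position after a round, if the automaton has a transition. -/
def move (y : I.Pos) (b : Fin I.nB) (i : Fin I.nI) : Option I.Pos :=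
  (I.A.step y.1 (i, I.T₂.out (I.T₂.step y.2 b))).map fun q => (q, I.T₂.step y.2 b)

/-- The position reached on an input word under a strategy. -/
def config (f : List (Fin I.nI) → Fin I.nB) (x : List (Fin I.nI)) : Option I.Pos :=
  (I.A.evalFrom I.A.start (x.zip (strategyWord I.T₂.strategy (strategyWord f x)))).map
    fun q => (q, I.T₂.state (strategyWord f x))

theorem config_nil (f : List (Fin I.nI) → Fin I.nB) : I.config f [] = some I.startPos := rfl

/-- Both word functions extend their output letter by letter, so the run on a prefix is never
revised. -/
theorem config_concat (f : List (Fin I.nI) → Fin I.nB) (x : List (Fin I.nI)) (i : Fin I.nI) :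
    I.config f (x ++ [i]) = (I.config f x).bind fun y => I.move y (f (x ++ [i])) i := by
  rw [config, config, strategyWord_concat, strategyWord_concat,
    List.zip_append (by simp only [length_strategyWord]), PartialDFA.evalFrom_append,
    Transducer.strategy, Transducer.state_concat]
  cases I.A.evalFrom I.A.start (x.zip (strategyWord I.T₂.strategy (strategyWord f x))) with
  | none => rfl
  | some q => simp [PartialDFA.evalFrom, move]

/-- Both relations are graphs of total functions, so the image condition is automatic, and inclusion
in the relation of `A` already forces both domains to contain all words. Only acceptance of each
composite output is left. -/
theorem meetsPD_iff (f : List (Fin I.nI) → Fin I.nB) :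
    MeetsPD I.A.rel (strategyRel f) I.T₂.rel ↔
      ∀ x, ∃ y, I.config f x = some y ∧ I.A.accept y.1 = true := by
  have hcomp (x : List (Fin I.nI)) (z : List (Fin I.nO)) :
      (x, z) ∈ (strategyRel f).comp I.T₂.rel ↔
        z = strategyWord I.T₂.strategy (strategyWord f x) :=
    ⟨fun ⟨_, h₁, h₂⟩ => h₂.trans (congrArg (strategyWord I.T₂.strategy) h₁),
      fun h => ⟨strategyWord f x, rfl, h⟩⟩
  have hrel (x : List (Fin I.nI)) :
      (x, strategyWord I.T₂.strategy (strategyWord f x)) ∈ I.A.rel ↔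
        ∃ y, I.config f x = some y ∧ I.A.accept y.1 = true := by
    constructor
    · rintro ⟨-, q, hq, ha⟩
      exact ⟨(q, _), by rw [config]; exact congrArg _ hq, ha⟩
    · rintro ⟨y, hy, ha⟩
      obtain ⟨q, hq, rfl⟩ := Option.map_eq_some_iff.1 hy
      exact ⟨by simp only [length_strategyWord], q, hq, ha⟩
  constructor
  · rintro ⟨-, -, h⟩ x
    exact (hrel x).1 (h ((hcomp x _).2 rfl))
  · intro h
    have hsub : (strategyRel f).comp I.T₂.rel ⊆ I.A.rel := by
      rintro ⟨x, z⟩ hz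
      rw [(hcomp x z).1 hz]
      exact (hrel x).2 (h x)
    refine ⟨fun w _ => ⟨strategyWord I.T₂.strategy w, rfl⟩, ?_, hsub⟩
    ext x
    exact ⟨fun ⟨z, hz⟩ => ⟨z, hsub hz⟩, fun _ => ⟨_, (hcomp x _).2 rfl⟩⟩

/-- The positions that are accepting and from which a set can be reached in one round, whatever
the next input letter is. -/
def safeStep (X : Set I.Pos) : Set I.Pos :=
  {y | I.A.accept y.1 = true ∧ ∀ i, ∃ b, ∃ z ∈ X, I.move y b i = some z}

/-- The positions that are safe for a number of rounds. -/
def safe : ℕ → Set I.Pos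
  | 0 => Set.univ
  | k + 1 => I.safeStep (safe k)

/-- The winning positions of the safety game. -/
def winning : Set I.Pos := I.safe (I.nQ * I.nP)

theorem safeStep_mono {X Y : Set I.Pos} (h : X ⊆ Y) : I.safeStep X ⊆ I.safeStep Y :=
  fun _ hy => ⟨hy.1, fun i => (hy.2 i).imp fun _ ⟨z, hz, hm⟩ => ⟨z, h hz, hm⟩⟩

theorem safe_succ_subset (k : ℕ) : I.safe (k + 1) ⊆ I.safe k := by
  induction k with
  | zero => exact Set.subset_univ _
  | succ k ih => exact I.safeStep_mono ih

/-- Each strict inclusion in the decreasing chain loses a position, and an equality persists. If the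
chain were still strict at index `nQ * nP`, more positions would have been lost than exist. -/
theorem safeStep_winning : I.safeStep I.winning = I.winning := by
  have key : ∀ k, I.safe (k + 1) = I.safe k ∨
      (I.safe (k + 1)).ncard + (k + 1) ≤ I.nQ * I.nP := by
    have hlt : ∀ k, I.safe (k + 1) ≠ I.safe k → (I.safe (k + 1)).ncard < (I.safe k).ncard :=
      fun k hk => Set.ncard_lt_ncard ((I.safe_succ_subset k).ssubset_of_ne hk) (Set.toFinite _)
    intro k
    induction k with
    | zero =>
      refine or_iff_not_imp_left.2 fun h => ?_
      have := hlt 0 h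
      have hu : (I.safe 0).ncard = I.nQ * I.nP := by simp [safe, Set.ncard_univ]
      omega
    | succ k ih =>
      refine or_iff_not_imp_left.2 fun h => ?_
      have := hlt (k + 1) h
      rcases ih with ih | ih
      · exact absurd (congrArg I.safeStep ih) h
      · omega
  rcases key (I.nQ * I.nP) with h | h
  · exact h
  · omega

theorem accept_of_mem_winning {y : I.Pos} (hy : y ∈ I.winning) : I.A.accept y.1 = true := by
  rw [← safeStep_winning] at hy
  exact hy.1

/-- If a strategy solves the instance, the start position is winning. -/
theorem startPos_mem_winning {f : List (Fin I.nI) → Fin I.nB}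
    (h : MeetsPD I.A.rel (strategyRel f) I.T₂.rel) : I.startPos ∈ I.winning := by
  rw [meetsPD_iff] at h
  -- All positions reached under `f` are treated at once; the answer of `f` to the next input leads
  -- to another such position.
  have key : ∀ k x y, I.config f x = some y → y ∈ I.safe k := by
    intro k
    induction k with
    | zero => exact fun _ _ _ => Set.mem_univ _
    | succ k ih =>
      intro x y hy
      refine ⟨?_, fun i => ⟨f (x ++ [i]), ?_⟩⟩
      · obtain ⟨y', hy', ha⟩ := h x
        rw [hy] at hy'
        rwa [Option.some_injective _ hy']
      · obtain ⟨z, hz, -⟩ := h (x ++ [i])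
        refine ⟨z, ih _ z hz, ?_⟩
        rwa [config_concat, hy] at hz
  exact key _ [] _ (I.config_nil f)

/-- A transducer that keeps track of the position and preserves the winning positions solves the
instance. -/
theorem meetsPD_of_tracks {σ : Type*} (T : Transducer (Fin I.nI) (Fin I.nB) σ) (d : σ → I.Pos)
    (hs : d T.start = I.startPos) (hw : I.startPos ∈ I.winning)
    (hd : ∀ s i, d s ∈ I.winning → I.move (d s) (T.out (T.step s i)) i = some (d (T.step s i)) ∧
      d (T.step s i) ∈ I.winning) : MeetsPD I.A.rel T.rel I.T₂.rel := by
  have key : ∀ x, I.config T.strategy x = some (d (T.state x)) ∧ d (T.state x) ∈ I.winning := by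
    intro x
    induction x using List.reverseRecOn with
    | nil => exact ⟨(I.config_nil _).trans (congrArg some hs.symm), hs ▸ hw⟩
    | append_singleton x i ih =>
      rw [config_concat, ih.1, Transducer.strategy, T.state_concat]
      exact hd _ i ih.2
  exact (I.meetsPD_iff _).2 fun x => ⟨_, (key x).1, I.accept_of_mem_winning (key x).2⟩

/-! ### The tree automaton of an instance -/

/-- The states of the tree automaton: a start state, and a position with the direction of the
current node. -/
abbrev TreeState : Type := Option (I.Pos × Fin I.nI)

/-- The position after the label of the current node has been read. -/
def treeMove (s : I.TreeState) (b : Fin I.nB) : Option I.Pos :=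
  (s.elim (some I.startPos) fun t => I.move t.1 b t.2).filter fun y => I.A.accept y.1

/-- The deterministic tree automaton that accepts the strategies solving the instance, with states
numbered by `e`. -/
def treeAutomaton {n : ℕ} (e : I.TreeState ≃ Fin n) :
    DetTreeAutomaton (Fin I.nI) (Fin I.nB) (Fin n) where
  step s b := (I.treeMove (e.symm s) b).map fun y v => some (e (some (y, v)))
  start := e none
  acc := Set.univ

/-- The run is forced: the copy at `x ++ [v]` holds the position after `x` and the direction `v`,
since the label needed for the move in direction `v` is only read at that node. At the root no move
is made, so its label is ignored. As every state is accepting, acceptance is mere existence of the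
run. -/
theorem treeAutomaton_accepts_iff {n : ℕ} (e : I.TreeState ≃ Fin n)
    (V : List (Fin I.nI) → Fin I.nB) :
    (I.treeAutomaton e).Accepts V ↔ MeetsPD I.A.rel (strategyRel V) I.T₂.rel := by
  rw [meetsPD_iff]
  constructor
  · rintro ⟨r, hr, -⟩ x
    have next (x : List (Fin I.nI)) (s : I.TreeState) (hx : r x = some (e s)) :
        ∃ y, I.treeMove s (V x) = some y ∧ ∀ v, r (x ++ [v]) = some (e (some (y, v))) := by
      obtain ⟨g, hg, hv⟩ := hr.child x _ hx
      obtain ⟨y, hy, rfl⟩ := Option.map_eq_some_iff.1 hg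
      exact ⟨y, by simpa using hy, hv⟩
    have key : ∃ y, (I.config V x = some y ∧ I.A.accept y.1 = true) ∧
        ∀ v, r (x ++ [v]) = some (e (some (y, v))) := by
      induction x using List.reverseRecOn with
      | nil =>
        obtain ⟨y, hy, hv⟩ := next [] none hr.root
        exact ⟨y, Option.filter_eq_some_iff.1 hy, hv⟩
      | append_singleton x i ih =>
        obtain ⟨y, ⟨hy, -⟩, hv⟩ := ih
        obtain ⟨z, hz, hv'⟩ := next (x ++ [i]) _ (hv i)
        rw [config_concat, hy]
        exact ⟨z, Option.filter_eq_some_iff.1 hz, hv'⟩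
    exact key.imp fun _ h => h.1
  · intro h
    let r (x : List (Fin I.nI)) : Option (Fin n) :=
      x.getLast?.elim (some (e none)) fun v => (I.config V x.dropLast).map fun y => e (some (y, v))
    have hr (x : List (Fin I.nI)) (v : Fin I.nI) :
        r (x ++ [v]) = (I.config V x).map fun y => e (some (y, v)) := by simp [r]
    refine ⟨r, ⟨rfl, fun x s hs => ?_, fun x hx => ?_⟩, fun d hd => Frequently.of_forall
      fun m => ?_⟩
    · obtain ⟨y, hy, ha⟩ := h x
      have hm : I.treeMove (e.symm s) (V x) = some y := by
        rcases List.eq_nil_or_concat' x with rfl | ⟨x, i, rfl⟩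
        · obtain rfl : e none = s := Option.some_injective _ hs
          rw [e.symm_apply_apply]
          exact Option.filter_eq_some_iff.2 ⟨hy, ha⟩
        · obtain ⟨z, hz, -⟩ := h x
          rw [hr, hz] at hs
          obtain rfl : e (some (z, i)) = s := Option.some_injective _ hs
          rw [config_concat, hz] at hy
          rw [e.symm_apply_apply]
          exact Option.filter_eq_some_iff.2 ⟨hy, ha⟩
      refine ⟨fun v => some (e (some (y, v))), by simp only [treeAutomaton, hm]; rfl,
        fun v => by rw [hr, hy]; rfl⟩
    · exfalso
      rcases List.eq_nil_or_concat' x with rfl | ⟨x, i, rfl⟩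
      · exact Option.some_ne_none _ hx
      · obtain ⟨z, hz, -⟩ := h x
        rw [hr, hz] at hx
        exact Option.some_ne_none _ hx
    · obtain ⟨s, hs⟩ := Option.isSome_iff_exists.1 (hd m)
      exact ⟨s, Set.mem_univ s, hs⟩

end HintInstance

/-! ### Addressing entries of concatenated tables -/

theorem List.getD_flatMap_of_length_eq {α β : Type*} {f : α → List β} {m : ℕ} {l : List α}
    (h : ∀ a ∈ l, (f a).length = m) {s r : ℕ} (hs : s < l.length) (hr : r < m) (d : β) :
    (l.flatMap f).getD (s * m + r) d = (f l[s]).getD r d := by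
  induction l generalizing s with
  | nil => simp at hs
  | cons a l ih =>
    have ha : (f a).length = m := h a (by simp)
    rw [List.flatMap_cons]
    cases s with
    | zero => rw [List.getD_append _ _ _ _ (by omega)]; simp
    | succ s =>
      have he : (s + 1) * m + r = m + (s * m + r) := by ring
      rw [List.getD_append_right _ _ _ _ (by omega), he, ha, Nat.add_sub_cancel_left]
      exact ih (fun b hb => h b (by simp [hb])) (by simpa using hs)

theorem List.getD_append_append {β : Type*} (u v w : List β) {n i : ℕ} (hn : n = u.length)
    (hi : i < v.length) (d : β) : (u ++ (v ++ w)).getD (n + i) d = v.getD i d := by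
  subst hn
  rw [List.getD_append_right _ _ _ _ (by omega), Nat.add_sub_cancel_left,
    List.getD_append _ _ _ _ hi]

theorem List.getD_map_finRange {β : Type*} {n : ℕ} (f : Fin n → β) (i : Fin n) (d : β) :
    ((List.finRange n).map f).getD i d = f i := by
  rw [List.getD_eq_getElem _ _ (by simp)]
  simp

theorem List.length_flatMap_of_length_eq {α β : Type*} {f : α → List β} {m : ℕ} {l : List α}
    (h : ∀ a ∈ l, (f a).length = m) : (l.flatMap f).length = l.length * m := by
  rw [List.length_flatMap, List.map_congr_left h, List.map_const', List.sum_replicate, smul_eq_mul]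

namespace HintInstance

/-! ### Table lookups -/

section Tables

variable (I : HintInstance)

/-- The table that represents an instance. -/
def tab : List ℕ := [I.nI, I.nB, I.nO] ++ I.A.table ++ I.T₂.table

/-- The position of the transition table of the automaton. -/
def offA : ℕ := 5 + I.nQ

/-- The position of the table of the hint. -/
def offT : ℕ := I.offA + I.nQ * (I.nI * I.nO)

/-- Acceptance of a state, looked up in the table. -/
def tabAccept (q : ℕ) : Bool := decide (0 < I.tab.getD (5 + q) 0)

/-- The successor of a state of the automaton, plus one, looked up in the table. -/
def tabStep (q i o : ℕ) : ℕ := I.tab.getD (I.offA + (q * (I.nI * I.nO) + (i * I.nO + o))) 0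

/-- The output letter of a state of the hint, looked up in the table. -/
def tabOut (p : ℕ) : ℕ := I.tab.getD (I.offT + 2 + p) 0

/-- The successor of a state of the hint, looked up in the table. -/
def tabNext (p b : ℕ) : ℕ := I.tab.getD (I.offT + 2 + I.nP + (p * I.nB + b)) 0

/-- The first part of the table of the automaton. -/
def headA : List ℕ := [I.nI, I.nB, I.nO, I.nQ, I.A.start]

/-- The acceptance bits of the automaton. -/
def acceptA : List ℕ := (List.finRange I.nQ).map fun s => if I.A.accept s then 1 else 0

/-- The transition table of the automaton. -/
def stepsA : List ℕ := (List.finRange I.nQ).flatMap fun s => (List.finRange I.nI).flatMap fun i =>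
  (List.finRange I.nO).map fun o => (I.A.step s (i, o)).elim 0 fun t => (t : ℕ) + 1

/-- The first part of the table of the hint. -/
def headT : List ℕ := [I.nP, I.T₂.start]

/-- The output letters of the hint. -/
def outsT : List ℕ := (List.finRange I.nP).map fun s => (I.T₂.out s : ℕ)

/-- The transition table of the hint. -/
def stepsT : List ℕ := (List.finRange I.nP).flatMap fun s => (List.finRange I.nB).map fun i =>
  (I.T₂.step s i : ℕ)

/-- The nesting to the right and the final `[]` put every block, including the last, in the middle
position required by `List.getD_append_append`. -/
theorem tab_eq : I.tab = I.headA ++ (I.acceptA ++ (I.stepsA ++ (I.headT ++ (I.outsT ++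
    (I.stepsT ++ []))))) := by
  simp [tab, headA, acceptA, stepsA, headT, outsT, stepsT, PartialDFA.table, Transducer.table]

theorem length_rowA (q : Fin I.nQ) : ((List.finRange I.nI).flatMap fun i =>
    (List.finRange I.nO).map fun o =>
      (I.A.step q (i, o)).elim 0 fun t => (t : ℕ) + 1).length = I.nI * I.nO := by
  rw [List.length_flatMap_of_length_eq (m := I.nO) (by simp), List.length_finRange]

theorem length_headA_acceptA : (I.headA ++ I.acceptA).length = I.offA := by
  simp [headA, acceptA, offA]; omega

theorem length_stepsA : I.stepsA.length = I.nQ * (I.nI * I.nO) := by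
  rw [stepsA, List.length_flatMap_of_length_eq fun q _ => I.length_rowA q, List.length_finRange]

theorem tabAccept_eq (q : Fin I.nQ) : I.tabAccept q = I.A.accept q := by
  rw [tabAccept, tab_eq, List.getD_append_append _ _ _ (by simp [headA]) (by simp [acceptA]),
    acceptA, List.getD_map_finRange]
  cases I.A.accept q <;> rfl

theorem tabStep_eq (q : Fin I.nQ) (i : Fin I.nI) (o : Fin I.nO) :
    I.tabStep q i o = (I.A.step q (i, o)).elim 0 fun t => (t : ℕ) + 1 := by
  -- Row-major addresses: the entry lies inside its row, and below, the row lies inside the table.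
  have h₁ : (i : ℕ) * I.nO + o < I.nI * I.nO :=
    calc (i : ℕ) * I.nO + o < (i + 1) * I.nO := by rw [Nat.succ_mul]; omega
      _ ≤ _ := Nat.mul_le_mul_right _ i.2
  have h₂ : (q : ℕ) * (I.nI * I.nO) + (i * I.nO + o) < I.nQ * (I.nI * I.nO) :=
    calc _ < ((q : ℕ) + 1) * (I.nI * I.nO) := by rw [Nat.succ_mul (q : ℕ)]; omega
      _ ≤ _ := Nat.mul_le_mul_right _ q.2
  rw [tabStep, tab_eq, ← List.append_assoc, List.getD_append_append _ _ _
    I.length_headA_acceptA.symm (by rwa [length_stepsA]), stepsA,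
    List.getD_flatMap_of_length_eq (fun q _ => I.length_rowA q) (by simp) h₁,
    List.getD_flatMap_of_length_eq (fun i _ => by simp) (by simp) o.2, List.getD_map_finRange]
  simp

theorem length_prefixT : (I.headA ++ I.acceptA ++ I.stepsA).length = I.offT := by
  rw [List.length_append, length_headA_acceptA, length_stepsA, offT]

theorem tabOut_eq (p : Fin I.nP) : I.tabOut p = I.T₂.out p := by
  rw [tabOut, tab_eq, ← List.append_assoc, ← List.append_assoc, ← List.append_assoc,
    List.getD_append_append _ _ _ (by rw [List.length_append, length_prefixT]; rfl)
    (by simp [outsT]), outsT, List.getD_map_finRange]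

theorem tabNext_eq (p : Fin I.nP) (b : Fin I.nB) : I.tabNext p b = I.T₂.step p b := by
  have h : (p : ℕ) * I.nB + b < I.nP * I.nB :=
    calc (p : ℕ) * I.nB + b < (p + 1) * I.nB := by rw [Nat.succ_mul]; omega
      _ ≤ _ := Nat.mul_le_mul_right _ p.2
  rw [tabNext, tab_eq, ← List.append_assoc, ← List.append_assoc, ← List.append_assoc,
    ← List.append_assoc, List.getD_append_append _ _ _
    (by rw [List.length_append, List.length_append, length_prefixT]; simp [headT, outsT])
    (by rw [stepsT, List.length_flatMap_of_length_eq (m := I.nB) (by simp)]; simpa using h),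
    stepsT, List.getD_flatMap_of_length_eq (fun i _ => by simp) (by simp) b.2,
    List.getD_map_finRange]
  simp

theorem getD_tab_nP : I.tab.getD I.offT 0 = I.nP := by
  rw [tab_eq, ← List.append_assoc, ← List.append_assoc]
  exact List.getD_append_append _ _ _ (i := 0) I.length_prefixT.symm (by simp [headT]) 0

theorem getD_tab_startT : I.tab.getD (I.offT + 1) 0 = I.T₂.start := by
  rw [tab_eq, ← List.append_assoc, ← List.append_assoc]
  exact List.getD_append_append _ _ _ I.length_prefixT.symm (by simp [headT]) 0

end Tables

/-! ### The game on numbered positions -/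

section Codes

variable (I : HintInstance)

/-- The number of a position. -/
def code (y : I.Pos) : ℕ := y.1 * I.nP + y.2

theorem code_lt (y : I.Pos) : I.code y < I.nQ * I.nP :=
  calc I.code y < (y.1 + 1) * I.nP := by rw [code, Nat.succ_mul]; omega
    _ ≤ _ := Nat.mul_le_mul_right _ y.1.2

theorem code_div (y : I.Pos) : I.code y / I.nP = y.1 := by
  have := y.2.2
  rw [code, mul_comm, Nat.mul_add_div (by omega), Nat.div_eq_of_lt y.2.2, add_zero]

theorem code_mod (y : I.Pos) : I.code y % I.nP = y.2 := by
  rw [code, mul_comm, Nat.mul_add_mod, Nat.mod_eq_of_lt y.2.2]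

/-- The position with a given number. -/
def decode (c : ℕ) (hc : c < I.nQ * I.nP) : I.Pos :=
  (⟨c / I.nP, Nat.div_lt_of_lt_mul (by rwa [mul_comm])⟩,
    ⟨c % I.nP, Nat.mod_lt _ (Nat.pos_of_ne_zero fun h => by simp [h] at hc)⟩)

theorem code_decode (c : ℕ) (hc : c < I.nQ * I.nP) : I.code (I.decode c hc) = c :=
  Nat.div_add_mod' c I.nP

theorem code_injective : Function.Injective I.code := fun y z h =>
  Prod.ext (Fin.ext (by rw [← code_div, h, code_div])) (Fin.ext (by rw [← code_mod, h, code_mod]))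

/-- The number of the position after a round, plus one, and zero if there is no transition. -/
def moveCode (c b i : ℕ) : ℕ :=
  let t := I.tabStep (c / I.nP) i (I.tabOut (I.tabNext (c % I.nP) b))
  if 0 < t then (t - 1) * I.nP + I.tabNext (c % I.nP) b + 1 else 0

theorem moveCode_code (y : I.Pos) (b : Fin I.nB) (i : Fin I.nI) :
    I.moveCode (I.code y) b i = (I.move y b i).elim 0 fun z => I.code z + 1 := by
  rw [moveCode, code_div, code_mod, tabNext_eq, tabOut_eq, tabStep_eq, move]
  cases I.A.step y.1 (i, I.T₂.out (I.T₂.step y.2 b)) <;> simp [code]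

/-- The chosen letter leads to a position in a set given by a list of bits. -/
def goodMove (W : List Bool) (c b i : ℕ) : Bool :=
  decide (0 < I.moveCode c b i) && W.getD (I.moveCode c b i - 1) false

/-- One round, on lists of bits. -/
def winStep (W : List Bool) : List Bool :=
  (List.range (I.nQ * I.nP)).map fun c => I.tabAccept (c / I.nP) &&
    (List.range I.nI).all fun i => (List.range I.nB).any fun b => I.goodMove W c b i

/-- The positions that are safe for a number of rounds, as a list of bits. -/
def winList : ℕ → List Bool
  | 0 => (List.range (I.nQ * I.nP)).map fun _ => true
  | k + 1 => I.winStep (winList k)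

theorem length_winList (k : ℕ) : (I.winList k).length = I.nQ * I.nP := by
  cases k <;> simp [winList, winStep]

theorem goodMove_code {W : List Bool} {X : Set I.Pos}
    (h : ∀ y, W.getD (I.code y) false = true ↔ y ∈ X) (y : I.Pos) (b : Fin I.nB) (i : Fin I.nI) :
    I.goodMove W (I.code y) b i = true ↔ ∃ z ∈ X, I.move y b i = some z := by
  rw [goodMove, moveCode_code]
  cases I.move y b i with
  | none => simp
  | some z => simp [← h, List.getD_eq_getElem?_getD]

theorem getD_winList (k : ℕ) (y : I.Pos) :
    (I.winList k).getD (I.code y) false = true ↔ y ∈ I.safe k := by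
  induction k generalizing y with
  | zero => simp [winList, safe, List.getD_eq_getElem?_getD, I.code_lt y]
  | succ k ih =>
    have hlt := I.code_lt y
    rw [List.getD_eq_getElem _ _ (by rwa [length_winList])]
    simp only [winList, winStep, List.getElem_map, List.getElem_range, code_div, tabAccept_eq,
      Bool.and_eq_true, List.all_eq_true, List.mem_range, List.any_eq_true]
    refine and_congr Iff.rfl ⟨fun h i => ?_, fun h i hi => ?_⟩
    · obtain ⟨b, hb, hg⟩ := h i i.2
      exact ⟨⟨b, hb⟩, (I.goodMove_code ih y ⟨b, hb⟩ i).1 hg⟩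
    · obtain ⟨b, hb⟩ := h ⟨i, hi⟩
      exact ⟨b, b.2, (I.goodMove_code ih y b ⟨i, hi⟩).2 hb⟩

/-- The winning positions, as a list of bits. -/
def winBits : List Bool := I.winList (I.nQ * I.nP)

theorem getD_winBits (y : I.Pos) : I.winBits.getD (I.code y) false = true ↔ y ∈ I.winning :=
  I.getD_winList _ y

/-- The least letter that preserves the winning positions, and the number of letters if there is
none. -/
def pick (c i : ℕ) : ℕ := (List.range I.nB).findIdx fun b => I.goodMove I.winBits c b i

/-! The states of the solution are positions with an output letter. -/

/-- The number of states of the solution. -/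
def numStates : ℕ := I.nQ * I.nP * I.nB

/-- The start state of the solution. -/
def startState : ℕ := I.code I.startPos * I.nB

/-- The transition function of the solution. -/
def nextState (s i : ℕ) : ℕ :=
  if I.pick (s / I.nB) i < I.nB then
    (I.moveCode (s / I.nB) (I.pick (s / I.nB) i) i - 1) * I.nB + I.pick (s / I.nB) i
  -- No letter is good here; the default only has to be a valid state number.
  else 0

theorem goodMove_pick {c i : ℕ} (h : I.pick c i < I.nB) :
    I.goodMove I.winBits c (I.pick c i) i = true := by
  have h' := List.findIdx_getElem (w := show (List.range I.nB).findIdx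
    (fun b => I.goodMove I.winBits c b i) < (List.range I.nB).length by
      rw [List.length_range]; exact h)
  rwa [List.getElem_range] at h'

variable {I}

theorem startState_lt (hB : 0 < I.nB) : I.startState < I.numStates :=
  Nat.mul_lt_mul_of_pos_right (I.code_lt _) hB

/-- A good move reads `true` from `winBits`, and lookups past its end give `false`. The target is
therefore in range even when `s` and `i` are arbitrary numbers. -/
theorem nextState_lt (hB : 0 < I.nB) (s i : ℕ) : I.nextState s i < I.numStates := by
  rw [nextState]
  split_ifs with h
  · have hg := I.goodMove_pick h
    rw [goodMove, Bool.and_eq_true] at hg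
    set c := I.moveCode (s / I.nB) (I.pick (s / I.nB) i) i - 1
    have hc : c < I.nQ * I.nP := by
      by_contra hc
      rw [List.getD_eq_default _ _ (by rw [winBits, length_winList]; omega)] at hg
      exact Bool.false_ne_true hg.2
    calc _ < (c + 1) * I.nB := by rw [Nat.succ_mul]; omega
      _ ≤ _ := Nat.mul_le_mul_right _ hc
  · exact (Nat.zero_le _).trans_lt (startState_lt hB)

/-- The solution computed from the winning positions. -/
def solution (hB : 0 < I.nB) : Transducer (Fin I.nI) (Fin I.nB) (Fin I.numStates) where
  step s i := ⟨I.nextState s i, nextState_lt hB s i⟩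
  start := ⟨I.startState, startState_lt hB⟩
  out s := ⟨s % I.nB, Nat.mod_lt _ hB⟩

/-- The output of a Moore machine belongs to the state reached, so a state stores the position
together with the letter just played; quotient and remainder by `nB` recover them. The letter stored
in the start state is irrelevant. -/
theorem meetsPD_solution (hB : 0 < I.nB) (hw : I.startPos ∈ I.winning) :
    MeetsPD I.A.rel (solution hB).rel I.T₂.rel := by
  have hdiv (s : Fin I.numStates) : s / I.nB < I.nQ * I.nP :=
    Nat.div_lt_of_lt_mul (by rw [mul_comm]; exact s.2)
  refine I.meetsPD_of_tracks _ (fun s => I.decode (s / I.nB) (hdiv s)) ?_ hw fun s i hs => ?_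
  · apply I.code_injective
    rw [code_decode]
    exact Nat.mul_div_cancel _ hB
  · set y := I.decode (s / I.nB) (hdiv s) with hy
    have hc : I.code y = s / I.nB := I.code_decode _ _
    rw [← safeStep_winning] at hs
    obtain ⟨b₀, hb₀⟩ := hs.2 i
    have hpick : I.pick (s / I.nB) i < I.nB := by
      rw [pick, ← hc]
      conv_rhs => rw [← List.length_range (n := I.nB)]
      exact List.findIdx_lt_length_of_exists ⟨b₀, by simp,
        (I.goodMove_code I.getD_winBits y b₀ i).2 hb₀⟩
    have hg : I.goodMove I.winBits (I.code y) (I.pick (s / I.nB) i) i = true := by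
      rw [hc]
      exact I.goodMove_pick hpick
    obtain ⟨z, hz, hm⟩ := (I.goodMove_code I.getD_winBits y ⟨_, hpick⟩ i).1 hg
    have hnext : I.nextState s i = I.code z * I.nB + I.pick (s / I.nB) i := by
      have := I.moveCode_code y ⟨_, hpick⟩ i
      rw [hm, hc] at this
      rw [nextState, if_pos hpick, this]
      rfl
    have hout : (solution hB).out ((solution hB).step s i) = ⟨_, hpick⟩ := by
      apply Fin.ext
      change I.nextState s i % I.nB = _
      rw [hnext, mul_comm, Nat.mul_add_mod, Nat.mod_eq_of_lt hpick]
    have hd : I.decode (((solution hB).step s i : ℕ) / I.nB) (hdiv _) = z := by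
      apply I.code_injective
      rw [code_decode]
      change I.nextState s i / I.nB = _
      rw [hnext, mul_comm, Nat.mul_add_div hB, Nat.div_eq_of_lt hpick, add_zero]
    rw [hout, hd]
    exact ⟨hm, hz⟩

variable (I) in
/-- The decision procedure. -/
def solvableBit : Bool := decide (0 < I.nB) && I.winBits.getD (I.code I.startPos) false

theorem solvableBit_iff' : I.solvableBit = true ↔ 0 < I.nB ∧ I.startPos ∈ I.winning := by
  rw [solvableBit, Bool.and_eq_true, getD_winBits, decide_eq_true_eq]

/-- Since `f` is an arbitrary strategy, this also covers trees with infinitely many distinct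
subtrees, as needed for nonemptiness. Its value at the root shows that `Σ_B` has a letter. -/
theorem solvableBit_of_meetsPD {f : List (Fin I.nI) → Fin I.nB}
    (h : MeetsPD I.A.rel (strategyRel f) I.T₂.rel) : I.solvableBit = true :=
  solvableBit_iff'.2 ⟨Fin.pos (f []), I.startPos_mem_winning h⟩

theorem solvableBit_iff : I.solvableBit = true ↔ I.Solvable :=
  ⟨fun h => ⟨⟨_, solution (solvableBit_iff'.1 h).1⟩,
    meetsPD_solution (solvableBit_iff'.1 h).1 (solvableBit_iff'.1 h).2⟩, fun ⟨_, h⟩ => solvableBit_of_meetsPD h⟩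

variable (I) in
/-- The search procedure. -/
def answer : Option I.Candidate :=
  if h : I.solvableBit = true then some ⟨_, solution (solvableBit_iff'.1 h).1⟩ else none

theorem isSolution_of_answer_eq_some {T₁ : I.Candidate} (h : I.answer = some T₁) :
    I.IsSolution T₁ := by
  rw [answer] at h
  split_ifs at h with hs
  rw [← Option.some_injective _ h]
  exact meetsPD_solution (solvableBit_iff'.1 hs).1 (solvableBit_iff'.1 hs).2

theorem not_solvable_of_answer_eq_none (h : I.answer = none) : ¬ I.Solvable := by
  rw [answer] at h
  split_ifs at h with hs
  rwa [solvableBit_iff] at hs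

variable (I) in
/-- The table of the solution. -/
def solutionTable : List ℕ :=
  [I.numStates] ++ [I.startState] ++ (List.range I.numStates).map (fun s => s % I.nB) ++
    (List.range I.numStates).flatMap fun s => (List.range I.nI).map fun i => I.nextState s i

theorem table_solution (hB : 0 < I.nB) : (solution hB).table = I.solutionTable := by
  rw [Transducer.table, solutionTable]
  simp only [← List.map_coe_finRange_eq_range, List.map_map, List.flatMap_map]
  rfl

theorem encodeAnswer_answer : I.encodeAnswer I.answer =
    if I.solvableBit then true :: encodeNats I.solutionTable else [false] := by
  rw [answer]
  split_ifs with h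
  · rw [← table_solution (solvableBit_iff'.1 h).1]; rfl
  · rfl

end Codes

end HintInstance

/-! ### The algorithm runs in polynomial time -/

instance : Reg HintInstance := ⟨HintInstance.encode⟩

instance : Regs HintInstance := ⟨fun I => [I.encode]⟩

namespace PT

variable {α : Type} [Regs α] {I : α → HintInstance}

/-- The string representing an instance is by definition the code of its table, so no computation
takes place. -/
theorem tab (hI : PT I) : PT fun a => (I a).tab := hI.of_toReg fun _ => rfl

theorem nI (hI : PT I) : PT fun a => (I a).nI := hI.tab.getD_nat (const 0)

theorem nB (hI : PT I) : PT fun a => (I a).nB := hI.tab.getD_nat (const 1)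

theorem nO (hI : PT I) : PT fun a => (I a).nO := hI.tab.getD_nat (const 2)

theorem nQ (hI : PT I) : PT fun a => (I a).nQ := hI.tab.getD_nat (const 3)

theorem offA (hI : PT I) : PT fun a => (I a).offA := (const 5).add hI.nQ

theorem offT (hI : PT I) : PT fun a => (I a).offT := hI.offA.add (hI.nQ.mul (hI.nI.mul hI.nO))

theorem nP (hI : PT I) : PT fun a => (I a).nP :=
  (hI.tab.getD_nat hI.offT).congr fun a => (I a).getD_tab_nP.symm

theorem startPos (hI : PT I) : PT fun a => (I a).code (I a).startPos :=
  (((hI.tab.getD_nat (const 4)).mul hI.nP).add (hI.tab.getD_nat hI.offT.succ)).congr fun a => by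
    rw [HintInstance.getD_tab_startT]; rfl

variable {c b i q p o : α → ℕ} {W : α → List Bool}

theorem tabAccept (hI : PT I) (hq : PT q) : PT fun a => (I a).tabAccept (q a) :=
  (const 0).lt (hI.tab.getD_nat ((const 5).add hq))

theorem tabStep (hI : PT I) (hq : PT q) (hi : PT i) (ho : PT o) :
    PT fun a => (I a).tabStep (q a) (i a) (o a) :=
  hI.tab.getD_nat (hI.offA.add ((hq.mul (hI.nI.mul hI.nO)).add ((hi.mul hI.nO).add ho)))

theorem tabOut (hI : PT I) (hp : PT p) : PT fun a => (I a).tabOut (p a) :=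
  hI.tab.getD_nat ((hI.offT.add (const 2)).add hp)

theorem tabNext (hI : PT I) (hp : PT p) (hb : PT b) : PT fun a => (I a).tabNext (p a) (b a) :=
  hI.tab.getD_nat (((hI.offT.add (const 2)).add hI.nP).add ((hp.mul hI.nB).add hb))

theorem moveCode (hI : PT I) (hc : PT c) (hb : PT b) (hi : PT i) :
    PT fun a => (I a).moveCode (c a) (b a) (i a) :=
  have hp := hI.tabNext (hc.mod hI.nP) hb
  have ht := hI.tabStep (hc.div hI.nP) hi (hI.tabOut hp)
  ht.ite_pos ((ht.pred.mul hI.nP).add hp).succ (const 0)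

theorem goodMove (hI : PT I) (hW : PT W) (hc : PT c) (hb : PT b) (hi : PT i) :
    PT fun a => (I a).goodMove (W a) (c a) (b a) (i a) :=
  have hm := hI.moveCode hc hb hi
  ((const 0).lt hm).and (hW.getD_bits hm.pred)

theorem winStep (hI : PT I) (hW : PT W) : PT fun a => (I a).winStep (W a) :=
  map_range_bool (hI.nQ.mul hI.nP) <| (hI.weaken.tabAccept (snd.div hI.weaken.nP)).and <|
    all_range hI.weaken.nI <| any_range hI.weaken.weaken.nB <|
      -- Three variables are in scope: `b` innermost, then `i`, then `c`.
      hI.weaken.weaken.weaken.goodMove hW.weaken.weaken.weaken snd.weaken.weaken snd snd.weaken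

theorem winBits (hI : PT I) : PT fun a => (I a).winBits :=
  have hN := hI.nQ.mul hI.nP
  iterate hN (map_range_bool hN (const true)) (hI.outer.winStep snd) (fun a => (I a).winList)
    (fun _ => rfl) (fun _ _ _ => rfl) hN.bdd fun a j _ => ((I a).length_winList j).le

/-- The winning positions are recomputed for each letter tested, which costs only a polynomial
factor. -/
theorem pick (hI : PT I) (hc : PT c) (hi : PT i) : PT fun a => (I a).pick (c a) (i a) :=
  findIdx_range hI.nB (hI.weaken.goodMove hI.weaken.winBits hc.weaken snd hi.weaken)

theorem numStates (hI : PT I) : PT fun a => (I a).numStates := (hI.nQ.mul hI.nP).mul hI.nB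

theorem nextState (hI : PT I) (hc : PT c) (hi : PT i) :
    PT fun a => (I a).nextState (c a) (i a) :=
  have hd := hc.div hI.nB
  have hp := hI.pick hd hi
  (((hp.lt hI.nB).ite (((hI.moveCode hd hp hi).pred.mul hI.nB).add hp) (const 0))).congr
    fun a => by simp only [HintInstance.nextState, decide_eq_true_eq]

theorem solvableBit (hI : PT I) : PT fun a => (I a).solvableBit :=
  ((const 0).lt hI.nB).and (hI.winBits.getD_bits hI.startPos)

theorem solutionTable (hI : PT I) : PT fun a => (I a).solutionTable :=
  ((hI.numStates.singleton_nat.append_nat (hI.startPos.mul hI.nB).singleton_nat).append_nat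
    (map_range_nat hI.numStates (snd.mod hI.weaken.nB))).append_nat
    (flatMap_range_nat hI.numStates (map_range_nat hI.weaken.nI
      (hI.weaken.weaken.nextState snd.weaken snd)))

theorem encodeAnswer (hI : PT I) : PT fun a => (I a).encodeAnswer (I a).answer := by
  have h : PT fun a => true :: encodeNats (I a).solutionTable :=
    hI.solutionTable.cons_bit true fun _ => rfl
  exact (hI.solvableBit.ite h (const [false])).congr fun a => (I a).encodeAnswer_answer

theorem hintInstance : PT fun I : HintInstance => I := var 0 fun _ => rfl

end PT

/-! ### Sizes -/

theorem length_encodeNats (l : List ℕ) : (encodeNats l).length = l.sum + l.length := by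
  induction l with
  | nil => rfl
  | cons x l ih => simp [encodeNats_cons, ih]; omega

/-- Numbers are written in unary, so the string is at least as long as the sum of the table entries.
-/
theorem HintInstance.le_length_encode (I : HintInstance) :
    I.nI + I.nB + I.nQ + I.nP ≤ I.encode.length := by
  change _ ≤ (encodeNats I.tab).length
  rw [length_encodeNats, tab_eq]
  simp only [headA, headT, List.sum_append, List.sum_cons, List.sum_nil]
  omega

/-! ### Decision, search and tree automaton together -/

theorem mainTheorem12 :
    -- the decision problem is in PTIME
    PolyTimeDecidable HintInstance.encode HintInstance.Solvable ∧
    -- a witness is computed in polynomial time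
    (∃ W : (I : HintInstance) → Option I.Candidate,
      (∀ I T₁, W I = some T₁ → I.IsSolution T₁) ∧
      (∀ I, W I = none → ¬ I.Solvable) ∧
      PolyTimeComputable HintInstance.encode (fun I => I.encodeAnswer (W I))) ∧
    -- a deterministic tree automaton of polynomial size accepts exactly the strategies that solve
    -- the instance together with the hint, and it is nonempty iff a transducer does
    (∃ p : Polynomial ℕ, ∀ I : HintInstance,
      ∃ (n : ℕ) (D : DetTreeAutomaton (Fin I.nI) (Fin I.nB) (Fin n)),
        D.size ≤ p.eval I.encode.length ∧
        (∀ V : List (Fin I.nI) → Fin I.nB,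
          D.Accepts V ↔ MeetsPD I.A.rel (strategyRel V) I.T₂.rel) ∧
        ((∃ V, D.Accepts V) ↔ I.Solvable)) := by
  refine ⟨⟨HintInstance.solvableBit, fun I => HintInstance.solvableBit_iff,
      PT.computableInPolyTime (fun _ => rfl) PT.hintInstance.solvableBit⟩,
    ⟨HintInstance.answer, fun I T₁ h => HintInstance.isSolution_of_answer_eq_some h,
      fun I h => HintInstance.not_solvable_of_answer_eq_none h,
      PT.computableInPolyTime (fun _ => rfl) PT.hintInstance.encodeAnswer⟩,
    -- There are `nQ * nP * nI + 1` states, at most the cube of the code length plus one; labels and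
    -- directions are each bounded by the length.
    (.X ^ 3 + 1) + .X + .X + (.X ^ 3 + 1) * .X * .X, fun I =>
      ⟨_, I.treeAutomaton (Fintype.equivFin I.TreeState), ?_, I.treeAutomaton_accepts_iff _,
        fun ⟨V, hV⟩ => ?_, fun ⟨T₁, h⟩ => ⟨_, (I.treeAutomaton_accepts_iff _ _).2 h⟩⟩⟩
  · have h := I.le_length_encode
    set L := I.encode.length
    have hcard : Fintype.card I.TreeState ≤ L ^ 3 + 1 := by
      simp only [Fintype.card_option, Fintype.card_prod, Fintype.card_fin, pow_succ, pow_zero,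
        one_mul]
      gcongr <;> omega
    simp only [DetTreeAutomaton.size, Polynomial.eval_add, Polynomial.eval_mul,
      Polynomial.eval_pow, Polynomial.eval_X, Polynomial.eval_one]
    gcongr <;> omega
  · rw [I.treeAutomaton_accepts_iff] at hV
    exact HintInstance.solvableBit_iff.1 (HintInstance.solvableBit_of_meetsPD hV)
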